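/- Let $F$ be a non-Archimedean local field with ring of integers $\mathcal O$, maximal ideal $\mathcal P$, residue field of cardinality $q$, uniformizer $\varpi$, and normalized absolute value $\|\cdot\|$ (so $\|\varpi\|=q^{-1}$). Let $G=\mathrm{PGL}(2,F)$, let $dg$ be a Haar measure on $G$, and let $t\in G$ be the image of $\mathrm{diag}(1,\varpi)$. Let $x:\mathcal O^\times\to\mathbb C^\times$ be a continuous character with $x^2\neq 1$. Let $d=d(x)\ge 0$ be the least integer $r$ such that $x^2$ is trivial on $U_r$, where $U_0=\mathcal O^\times$ and $U_r=1+\mathcal P^r$ for $r>0$ (so $d>0$). Let $\Gamma_d\subset G$ be the image of $\{\gamma\in \mathrm{GL}(2,\mathcal O):\gamma_{21}\in\mathcal P^d\}$, with its character $\tilde x(\gamma)=x(\gamma_{11}^2/\det\gamma)$. Let $\mathcal H'_x$ be the algebra, under convolution, of the measures $\mu=f\,dg$ with $f:G\to\mathbb C$ locally constant and compactly supported such that $f(\gamma g)=f(g\gamma)=\tilde x(\gamma)f(g)$ for all $\gamma\in\Gamma_d$, $g\in G$; its unit is $\mu_0/\mathrm{vol}(\Gamma_d,dg)$, where for $n\in\mathbb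 Z$ we put $\mu_n=\phi_n\,dg$, with $\phi_n$ the (well-defined) function supported on $\Gamma_d t^n\Gamma_d$ such that $\phi_n(\gamma' t^n\gamma'')=\tilde x(\gamma'\gamma'')$ for $\gamma',\gamma''\in\Gamma_d$. Let $\Theta_x$ be the set of continuous characters $\theta:F^\times\to\mathbb C^\times$ with $\theta|_{\mathcal O^\times}=x$; the map $\theta\mapsto z=\theta(\varpi)$ is a bijection $\Theta_x\to\mathbb C^\times$, by which the algebra $\mathbb C[\Theta_x]$ of regular functions on $\Theta_x$ is identified with $\mathbb C[z,z^{-1}]$. For $\theta\in\Theta_x$ let $\pi_\theta$ be the representation of $G$ by left shifts, $(\pi_\theta(h)f)(g)=f(h^{-1}g)$, on the space $R_\theta$ of locally constant functions $f:G\to\mathbb C$ with $f(gb)=\theta(\bar b)\|\bar b\|^{1/2}f(g)$ for all $g\in G$ and all upper triangular $b$, where $\bar b=b_{11}/b_{22}$. For $\mu\in\mathcal H'_x$ the operator $\pi_\theta(\mu)=\int_G\pi_\theta(g)\,\mu(g)$ has finite rank; let $\hat\mu(\pi_\theta)$ be its trace. Then: (a) The map sending $\mu$ to the function $\theta\mapsto\hat\mu(\pi_\theta)$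 on $\Theta_x$ is an isomorphism of algebras $\mathcal H'_x\to\mathbb C[\Theta_x]=\mathbb C[z,z^{-1}]$. (b) For every $n\in\mathbb Z$ there is a constant $c\neq 0$, independent of $\theta$, such that $\hat\mu_n(\pi_\theta)=c\,z^n$ for all $\theta\in\Theta_x$, where $z=\theta(\varpi)$. (c) The family $(\mu_n)_{n\in\mathbb Z}$ is a basis of the complex vector space $\mathcal H'_x$. -/

import Mathlib

open scoped ValuativeRel MatrixGroups LaurentPolynomial
open MeasureTheory

noncomputable section

namespace PGL2Hecke

variable (F : Type*) [Field F] [ValuativeRel F] [TopologicalSpace F] [IsNonarchimedeanLocalField F]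

/-! ### The local field and its characters -/

/-- The inclusion of the units of the ring of integers into the multiplicative group of `F`. -/
def unitsIncl : 𝒪[F]ˣ →* Fˣ := Units.map (Subring.subtype 𝒪[F]).toMonoidHom

variable {F}

/-- The normalized valuation `Fˣ → ℤ`, of value `1` at every uniformizer. -/
def val (a : Fˣ) : ℤ :=
  -WithZero.log (IsNonarchimedeanLocalField.valueGroupWithZeroIsoInt F
    (ValuativeRel.valuation F (a : F)))

/-- The normalized absolute value `‖a‖ = q ^ (-val a)`, where `q` is the cardinality of the
residue field. -/
def normAbs (a : Fˣ) : ℝ := (Nat.card 𝓀[F] : ℝ) ^ (-val a)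

/-- The (continuous) characters `θ` of `Fˣ` whose restriction to the units of the ring of
integers is `x`. -/
def Theta (x : 𝒪[F]ˣ →ₜ* ℂˣ) : Type _ :=
  {θ : Fˣ →ₜ* ℂˣ // ∀ u : 𝒪[F]ˣ, θ (unitsIncl F u) = x u}

/-- The depth `d(x)`: the least `r ≥ 0` such that `x ^ 2` is trivial on `U_r`, where
`U_0` is the group of all units and `U_r = 1 + 𝓂 ^ r` for `r > 0`. -/
def depth (x : 𝒪[F]ˣ →ₜ* ℂˣ) : ℕ :=
  sInf {r : ℕ | ∀ u : 𝒪[F]ˣ, (u : 𝒪[F]) - 1 ∈ 𝓂[F] ^ r → x u ^ 2 = 1}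

open scoped Classical in
/-- A character of the units of the ring of integers, extended by `0` to `F`. -/
def extZero (x : 𝒪[F]ˣ →ₜ* ℂˣ) (a : F) : ℂ :=
  if h : ∃ u : 𝒪[F]ˣ, ((u : 𝒪[F]) : F) = a then (x h.choose : ℂ) else 0

/-- The unit of `F` given by a uniformizer. -/
def unif (ϖ : 𝒪[F]) (hϖ : Irreducible ϖ) : Fˣ :=
  Units.mk0 (ϖ : F) (by simpa using hϖ.ne_zero)

/-! ### The group `PGL(2, F)` and some of its subgroups -/

/-- The quotient topology. -/
instance : TopologicalSpace PGL(2, F) :=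
  inferInstanceAs (TopologicalSpace (GL (Fin 2) F ⧸ Subgroup.center (GL (Fin 2) F)))

instance : IsTopologicalGroup PGL(2, F) :=
  inferInstanceAs (IsTopologicalGroup (GL (Fin 2) F ⧸ Subgroup.center (GL (Fin 2) F)))

/-- The upper triangular matrix with diagonal `a, b` and upper right entry `u`. -/
def upperTri (a b : Fˣ) (u : F) : GL (Fin 2) F :=
  Matrix.GeneralLinearGroup.mkOfDetNeZero !![(a : F), u; 0, (b : F)] (by simp)

/-- The image in `PGL(2, F)` of the diagonal matrix with entries `1, ϖ`. -/
def tElt (ϖ : 𝒪[F]) (hϖ : Irreducible ϖ) : PGL(2, F) :=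
  Matrix.ProjGenLinGroup.mk (upperTri 1 (unif ϖ hϖ) 0)

/-- The natural map from `GL(2, 𝒪)` to `PGL(2, F)`. -/
def intToPGL : GL (Fin 2) 𝒪[F] →* PGL(2, F) :=
  Matrix.ProjGenLinGroup.mk.comp (Matrix.GeneralLinearGroup.map (Subring.subtype 𝒪[F]))

variable (F) in
/-- The subgroup of matrices in `GL(2, 𝒪)` whose lower left entry is in `𝓂 ^ d`. -/
def GammaTilde (d : ℕ) : Subgroup (GL (Fin 2) 𝒪[F]) where
  carrier := {γ | γ 1 0 ∈ 𝓂[F] ^ d}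
  one_mem' := by simp
  mul_mem' {a b} ha hb := by
    simp only [Set.mem_ofPred_eq, Units.val_mul, Matrix.mul_apply, Fin.sum_univ_two] at *
    exact Ideal.add_mem _ (Ideal.mul_mem_right _ _ ha) (Ideal.mul_mem_left _ _ hb)
  inv_mem' {a} ha := by
    simp only [Set.mem_ofPred_eq, Matrix.coe_units_inv, Matrix.inv_def, Matrix.adjugate_fin_two] at *
    simpa using (𝓂[F] ^ d).mul_mem_left (Ring.inverse (a : Matrix (Fin 2) (Fin 2) 𝒪[F]).det) ha

variable (F) in
/-- The subgroup `Γ_d` of `PGL(2, F)`. -/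
def Gamma (d : ℕ) : Subgroup PGL(2, F) := (GammaTilde F d).map intToPGL

/-- The function `g ↦ g₁₁² / det g` on `PGL(2, F)`, computed on any representative. -/
def ratio (g : PGL(2, F)) : F :=
  Quotient.liftOn' g (fun m : GL (Fin 2) F => m 0 0 ^ 2 / (m : Matrix (Fin 2) (Fin 2) F).det) (by
    intro a b hab
    obtain ⟨u, rfl⟩ := Matrix.ProjGenLinGroup.mk_eq_mk_iff.1
      (show Matrix.ProjGenLinGroup.mk a = Matrix.ProjGenLinGroup.mk b from Quotient.sound' hab)
    have hu : (u : F) ≠ 0 := u.ne_zero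
    simp only [Matrix.GeneralLinearGroup.coe_scalar, Units.val_mul, Matrix.det_mul,
      Matrix.scalar_apply, Matrix.mul_diagonal, Matrix.det_diagonal, Fin.prod_univ_two]
    field_simp)

/-- The character `γ ↦ x (γ₁₁² / det γ)` of `Γ_d`, `d = d(x) > 0`, given as a function on
`PGL(2, F)`; it is only ever evaluated on `Γ_d`, where `γ₁₁² / det γ` is a unit. -/
def xTilde (x : 𝒪[F]ˣ →ₜ* ℂˣ) (g : PGL(2, F)) : ℂ := extZero x (ratio g)

/-! ### The Hecke algebra -/

variable (F) in
/-- The locally constant compactly supported functions on `PGL(2, F)`; after the choice of a Haar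
measure `dg`, the map `f ↦ f dg` identifies them with the compactly supported smooth measures. -/
def testFun : Submodule ℂ (PGL(2, F) → ℂ) where
  carrier := {f | IsLocallyConstant f ∧ HasCompactSupport f}
  add_mem' {_ _} ha hb := ⟨ha.1.add hb.1, ha.2.add hb.2⟩
  zero_mem' := ⟨IsLocallyConstant.const 0, HasCompactSupport.zero⟩
  smul_mem' c _ hf := ⟨hf.1.comp (fun z => c • z), hf.2.smul_left (f := fun _ => c)⟩

/-- Convolution: `(f dg) ∗ (h dg) = (conv dg f h) dg`. -/
def conv [MeasurableSpace PGL(2, F)] (dg : Measure PGL(2, F)) (f h : PGL(2, F) → ℂ) :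
    PGL(2, F) → ℂ :=
  fun g => ∫ y, f y * h (y⁻¹ * g) ∂dg

/-- The (densities with respect to `dg` of the) compactly supported smooth measures on which left
and right translation by `γ ∈ Γ_d`, `d = d(x)`, are multiplication by `x̃(γ)`. -/
def heckeX (x : 𝒪[F]ˣ →ₜ* ℂˣ) : Submodule ℂ (PGL(2, F) → ℂ) where
  carrier := {f | f ∈ testFun F ∧ ∀ γ ∈ Gamma F (depth x), ∀ g,
    f (γ * g) = xTilde x γ * f g ∧ f (g * γ) = xTilde x γ * f g}
  add_mem' {a b} ha hb := by
    refine ⟨add_mem ha.1 hb.1, fun γ hγ g => ⟨?_, ?_⟩⟩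
    · simp only [Pi.add_apply, (ha.2 γ hγ g).1, (hb.2 γ hγ g).1]; ring
    · simp only [Pi.add_apply, (ha.2 γ hγ g).2, (hb.2 γ hγ g).2]; ring
  zero_mem' := ⟨zero_mem _, by simp⟩
  smul_mem' c f hf := by
    refine ⟨Submodule.smul_mem _ c hf.1, fun γ hγ g => ⟨?_, ?_⟩⟩
    · simp only [Pi.smul_apply, smul_eq_mul, (hf.2 γ hγ g).1]; ring
    · simp only [Pi.smul_apply, smul_eq_mul, (hf.2 γ hγ g).2]; ring

lemma heckeX_le (x : 𝒪[F]ˣ →ₜ* ℂˣ) : heckeX x ≤ testFun F := fun _ h => h.1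

open scoped Classical in
/-- The function `φ_n` supported on the double coset `Γ_d tⁿ Γ_d`, with
`φ_n (γ' tⁿ γ'') = x̃ (γ' γ'')` there. -/
def phi (x : 𝒪[F]ˣ →ₜ* ℂˣ) (ϖ : 𝒪[F]) (hϖ : Irreducible ϖ) (n : ℤ) (g : PGL(2, F)) : ℂ :=
  if h : ∃ p : Gamma F (depth x) × Gamma F (depth x),
      g = (p.1 : PGL(2, F)) * tElt ϖ hϖ ^ n * (p.2 : PGL(2, F)) then
    xTilde x ((h.choose.1 : PGL(2, F)) * (h.choose.2 : PGL(2, F)))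
  else 0

/-! ### The induced representations -/

/-- The space `R_θ` of the locally constant functions `f` on `PGL(2, F)` with
`f (g b) = θ (b̄) ‖b̄‖ ^ (1 / 2) f (g)` for upper triangular `b`, where `b̄ = b₁₁ / b₂₂`. -/
def inducedSpace (θ : Fˣ →ₜ* ℂˣ) : Submodule ℂ (PGL(2, F) → ℂ) where
  carrier := {f | IsLocallyConstant f ∧ ∀ (g : PGL(2, F)) (a b : Fˣ) (u : F),
    f (g * Matrix.ProjGenLinGroup.mk (upperTri a b u)) =
      (θ (a / b) : ℂ) * (Real.sqrt (normAbs (a / b)) : ℂ) * f g}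
  add_mem' {_ _} ha hb := by
    refine ⟨ha.1.add hb.1, fun g a b u => ?_⟩
    simp only [Pi.add_apply, ha.2, hb.2]; ring
  zero_mem' := ⟨IsLocallyConstant.const 0, by simp⟩
  smul_mem' c f hf := by
    refine ⟨hf.1.comp (fun z => c • z), fun g a b u => ?_⟩
    simp only [Pi.smul_apply, smul_eq_mul, hf.2]; ring

/-- The representation `π_θ` of `PGL(2, F)` on `R_θ` by left shifts,
`(π_θ (g) f) (h) = f (g⁻¹ h)`. -/
def piTheta (θ : Fˣ →ₜ* ℂˣ) : Representation ℂ PGL(2, F) (inducedSpace θ) where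
  toFun g :=
    { toFun := fun f => ⟨fun h => (f : PGL(2, F) → ℂ) (g⁻¹ * h), by
        refine ⟨f.2.1.comp_continuous (continuous_const.mul continuous_id), fun h a b u => ?_⟩
        simpa only [mul_assoc] using f.2.2 (g⁻¹ * h) a b u⟩
      map_add' := fun _ _ => rfl
      map_smul' := fun _ _ => rfl }
  map_one' := by ext f h; simp
  map_mul' g g' := by ext f h; simp [mul_assoc]

lemma piTheta_apply (θ : Fˣ →ₜ* ℂˣ) (g : PGL(2, F)) (v : inducedSpace θ) (h : PGL(2, F)) :
    (piTheta θ g v : PGL(2, F) → ℂ) h = (v : PGL(2, F) → ℂ) (g⁻¹ * h) := rfl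

/-- A locally constant compactly supported function is invariant under left shifts by the
elements of a neighbourhood of `1`. -/
lemma eventually_left_invariant (f : testFun F) :
    ∀ᶠ u in nhds (1 : PGL(2, F)), ∀ g, (f : PGL(2, F) → ℂ) (u * g) = (f : PGL(2, F) → ℂ) g := by
  have h1 : ∀ᶠ u in nhds (1 : PGL(2, F)), ∀ g ∈ tsupport (f : PGL(2, F) → ℂ),
      (f : PGL(2, F) → ℂ) (u * g) = (f : PGL(2, F) → ℂ) g := by
    refine f.2.2.isCompact.eventually_forall_of_forall_eventually fun g _ => ?_
    have hm : Filter.Tendsto (fun p : PGL(2, F) × PGL(2, F) => p.1 * p.2) (nhds (1, g))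
        (nhds g) := by
      simpa using (continuous_mul (M := PGL(2, F))).tendsto (1, g)
    have hc := (IsLocallyConstant.iff_eventually_eq _).1 f.2.1 g
    filter_upwards [hm.eventually hc, (continuous_snd.tendsto (1, g)).eventually hc] with p h h'
    exact h.trans h'.symm
  have h2 := (continuous_inv (G := PGL(2, F))).tendsto 1
  rw [inv_one] at h2
  filter_upwards [h1, h2.eventually h1] with u hu hu' g
  by_cases hg : g ∈ tsupport (f : PGL(2, F) → ℂ)
  · exact hu g hg
  · by_cases hug : u * g ∈ tsupport (f : PGL(2, F) → ℂ)
    · simpa using (hu' _ hug).symm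
    · rw [image_eq_zero_of_notMem_tsupport hg, image_eq_zero_of_notMem_tsupport hug]

section integrated

variable [MeasurableSpace PGL(2, F)] [BorelSpace PGL(2, F)]
  (dg : Measure PGL(2, F)) [dg.IsHaarMeasure]

lemma integrable_piTheta (θ : Fˣ →ₜ* ℂˣ) (f : testFun F) (v : inducedSpace θ) (h : PGL(2, F)) :
    Integrable (fun g => (f : PGL(2, F) → ℂ) g * (piTheta θ g v : PGL(2, F) → ℂ) h) dg := by
  refine Continuous.integrable_of_hasCompactSupport ?_ (f.2.2.mul_right)
  refine f.2.1.continuous.mul (v.2.1.continuous.comp ?_)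
  exact (continuous_inv.mul continuous_const)

/-- The operator `π_θ (f dg) = ∫ f (g) π_θ (g) dg` on `R_θ`. -/
def piOp (θ : Fˣ →ₜ* ℂˣ) (f : testFun F) : Module.End ℂ (inducedSpace θ) where
  toFun v := ⟨fun h => ∫ g, (f : PGL(2, F) → ℂ) g * (piTheta θ g v : PGL(2, F) → ℂ) h ∂dg, by
    refine ⟨?_, fun h a b u => ?_⟩
    · refine (IsLocallyConstant.iff_eventually_eq _).2 fun h => ?_
      have ht : Filter.Tendsto (fun h' : PGL(2, F) => h' * h⁻¹) (nhds h) (nhds 1) := by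
        simpa using (continuous_mul_const (h⁻¹ : PGL(2, F))).tendsto h
      filter_upwards [ht.eventually (eventually_left_invariant f)] with h' hu
      rw [← integral_mul_left_eq_self _ (h' * h⁻¹)]
      refine integral_congr_ae (Filter.Eventually.of_forall fun g => ?_)
      simp only [piTheta_apply]
      rw [hu]
      congr 2
      group
    · rw [← integral_const_mul]
      refine integral_congr_ae (Filter.Eventually.of_forall fun g => ?_)
      simp only [(piTheta θ g v).2.2]
      ring⟩
  map_add' v w := by
    ext h
    simp only [map_add, Submodule.coe_add, Pi.add_apply, mul_add]
    exact integral_add (integrable_piTheta dg θ f v h) (integrable_piTheta dg θ f w h)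
  map_smul' c v := by
    ext h
    simp only [map_smul, Submodule.coe_smul, Pi.smul_apply, smul_eq_mul, RingHom.id_apply]
    rw [← integral_const_mul]
    congr 1; ext g; ring

end integrated

/-- The trace of a linear operator of finite rank: the trace of its restriction to its range. -/
def finRankTrace {V : Type*} [AddCommGroup V] [Module ℂ V] (A : Module.End ℂ V) : ℂ :=
  LinearMap.trace ℂ (LinearMap.range A)
    (A.restrict (p := LinearMap.range A) (q := LinearMap.range A) fun v _ => ⟨v, rfl⟩)

end PGL2Hecke

end

open PGL2Hecke

/-!
For `θ ∈ Θ_x`, the vectors of `R_θ` on which `Γ_d` acts by `x̃` form a line: away from the cell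
`Γ_d B`, a unit `y` close to `1` with `x(y)² ≠ 1` forces such a vector to vanish. Hence `π_θ(f)`
has rank at most one for `f ∈ H'_x`, and its trace is the scalar `λ_θ(f)` by which `f` acts on
that line; in particular `λ_θ` is a character of the algebra `H'_x`. Evaluated at `1`, the action
of `φ_n` on the vector gives `λ_θ(φ_n) = c_n zⁿ` with `c_n ≠ 0` independent of `θ`. By a similar
use of `y`, the elements of `H'_x` are supported on the union of the double cosets `Γ_d tⁿ Γ_d`,
so the `φ_n` span `H'_x`. Since Laurent polynomials are separated by their values at all `z = θ(ϖ)
∈ ℂˣ`, sending `φ_n` to `c_n zⁿ` is the isomorphism sought.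
-/

noncomputable section

namespace PGL2Hecke

open Matrix.ProjGenLinGroup (mk)

/-! ### No small subgroups, and the depth of a character -/

section LocallyTrivial

lemma eq_one_of_forall_norm_pow_sub_one_le {A : Type*} [NormedDivisionRing A] [NormedAlgebra ℝ A]
    {z : A} (h : ∀ n : ℕ, ‖z ^ n - 1‖ ≤ 1 / 2) : z = 1 := by
  have norm_add_one_ge (n : ℕ) : 3 / 2 ≤ ‖z ^ n + 1‖ := by
    have htwo : ‖(2 : A)‖ = 2 := by
      rw [← map_ofNat (algebraMap ℝ A) 2, norm_algebraMap', Real.norm_ofNat]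
    have := norm_sub_le (z ^ n + 1) (z ^ n - 1)
    rw [show z ^ n + 1 - (z ^ n - 1) = 2 by abel_nf; simp, htwo] at this
    linarith [h n]
  have growth (k : ℕ) : (3 / 2 : ℝ) ^ k * ‖z - 1‖ ≤ ‖z ^ 2 ^ k - 1‖ := by
    induction k with
    | zero => simp
    | succ k ih =>
      calc (3 / 2 : ℝ) ^ (k + 1) * ‖z - 1‖ = 3 / 2 * ((3 / 2) ^ k * ‖z - 1‖) := by ring
        _ ≤ ‖z ^ 2 ^ k + 1‖ * ‖z ^ 2 ^ k - 1‖ := by gcongr; exact norm_add_one_ge _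
        _ = ‖z ^ 2 ^ (k + 1) - 1‖ := by
          rw [← norm_mul, pow_succ, pow_mul, pow_two (z ^ 2 ^ k)]; congr 1; noncomm_ring
  by_contra hz
  have hpos : 0 < ‖z - 1‖ := norm_pos_iff.2 (sub_ne_zero.2 hz)
  obtain ⟨k, hk⟩ := pow_unbounded_of_one_lt (1 / ‖z - 1‖) (by norm_num : (1 : ℝ) < 3 / 2)
  rw [div_lt_iff₀ hpos] at hk
  linarith [growth k, h (2 ^ k)]

variable {R : Type*} [CommRing R] [TopologicalSpace R] [IsTopologicalRing R] [CompactSpace R]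
  [T2Space R] [IsLocalRing R] [IsNoetherianRing R]

open IsLocalRing in
lemma exists_forall_sub_one_mem_pow_of_mem_nhds_one {U : Set Rˣ} (hU : U ∈ nhds 1) :
    ∃ r : ℕ, ∀ u : Rˣ, (u : R) - 1 ∈ maximalIdeal R ^ r → u ∈ U := by
  refine exists_subset_nhds_of_isCompact
    (V := fun r => {u : Rˣ | (u : R) - 1 ∈ maximalIdeal R ^ r}) ?_ (fun r => ?_) fun u hu => ?_
  · have hanti : Antitone fun r => {u : Rˣ | (u : R) - 1 ∈ maximalIdeal R ^ r} :=
      fun m n hmn u hu => Ideal.pow_le_pow_right hmn hu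
    exact hanti.directed_ge
  · have : IsClosed ((maximalIdeal R ^ r : Ideal R) : Set R) :=
      (maximalIdeal R ^ r).toAddSubgroup.isClosed_of_isOpen (isOpen_maximalIdeal_pow R r)
    exact (this.preimage (Units.continuous_val.sub continuous_const)).isCompact
  · suffices (u : R) - 1 ∈ ⨅ r, maximalIdeal R ^ r by
      rw [Ideal.iInf_pow_eq_bot_of_isLocalRing _ (Ideal.IsPrime.ne_top inferInstance),
        Ideal.mem_bot, sub_eq_zero, Units.val_eq_one] at this
      rwa [this]
    simpa [Submodule.mem_iInf] using hu

open IsLocalRing in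
lemma exists_forall_sub_one_mem_pow_imp_eq_one (x : Rˣ →ₜ* ℂˣ) :
    ∃ r : ℕ, ∀ u : Rˣ, (u : R) - 1 ∈ maximalIdeal R ^ r → x u = 1 := by
  have hx : Continuous fun u => ‖(x u : ℂ) - 1‖ :=
    ((Units.continuous_val.comp x.continuous_toFun).sub continuous_const).norm
  obtain ⟨r, hr⟩ := exists_forall_sub_one_mem_pow_of_mem_nhds_one <|
    hx.continuousAt.eventually_lt continuousAt_const (show ‖(x 1 : ℂ) - 1‖ < 1 / 2 by simp)
  refine ⟨r, fun u hu => Units.ext (eq_one_of_forall_norm_pow_sub_one_le fun n => ?_)⟩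
  have hun : ((u ^ n : Rˣ) : R) - 1 ∈ maximalIdeal R ^ r := by
    rw [Units.val_pow_eq_pow_val]
    exact Ideal.mem_of_dvd _ (sub_one_dvd_pow_sub_one _ n) hu
  have hlt : ‖(x (u ^ n) : ℂ) - 1‖ < 1 / 2 := hr _ hun
  simpa using hlt.le

end LocallyTrivial

section Depth

variable {F : Type*} [Field F] [ValuativeRel F] [TopologicalSpace F] [IsNonarchimedeanLocalField F]

instance : T2Space F := by
  let := IsTopologicalAddGroup.rightUniformSpace F
  have := isUniformAddGroup_of_addCommGroup (G := F)
  have : T0Space F := inferInstance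
  infer_instance

lemma sq_eq_one_of_sub_one_mem (x : 𝒪[F]ˣ →ₜ* ℂˣ) {u : 𝒪[F]ˣ}
    (hu : (u : 𝒪[F]) - 1 ∈ 𝓂[F] ^ depth x) : x u ^ 2 = 1 := by
  obtain ⟨r, hr⟩ := exists_forall_sub_one_mem_pow_imp_eq_one x
  exact Nat.sInf_mem
    (s := {r : ℕ | ∀ u : 𝒪[F]ˣ, (u : 𝒪[F]) - 1 ∈ 𝓂[F] ^ r → x u ^ 2 = 1})
    ⟨r, fun u hu => by rw [hr u hu, one_pow]⟩ u hu

lemma depth_pos {x : 𝒪[F]ˣ →ₜ* ℂˣ} (hx : x ^ 2 ≠ 1) : 0 < depth x := by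
  refine Nat.pos_of_ne_zero fun h => hx ?_
  ext u
  simpa using congrArg Units.val (sq_eq_one_of_sub_one_mem x (u := u) (by simp [h]))

lemma exists_sq_ne_one {x : 𝒪[F]ˣ →ₜ* ℂˣ} (hx : x ^ 2 ≠ 1) :
    ∃ u : 𝒪[F]ˣ, (u : 𝒪[F]) - 1 ∈ 𝓂[F] ^ (depth x - 1) ∧ x u ^ 2 ≠ 1 := by
  by_contra! h
  exact Nat.notMem_of_lt_sInf (Nat.sub_lt (depth_pos hx) one_pos) h

end Depth

/-! ### Characters of the multiplicative group -/

section DiscreteValuationRing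

open IsLocalRing

variable {R K : Type*} [CommRing R] [IsDomain R] [IsDiscreteValuationRing R] [Field K]
  [Algebra R K]

lemma exists_mem_maximalIdeal_pow_algebraMap_eq {ϖ : R} (hϖ : Irreducible ϖ) {i : ℕ} {n : ℤ}
    (h : i ≤ n) (r : R) :
    ∃ e ∈ maximalIdeal R ^ i, algebraMap R K e = algebraMap R K r * algebraMap R K ϖ ^ n := by
  lift n to ℕ using by omega
  refine ⟨r * ϖ ^ n, ?_, by simp⟩
  rw [hϖ.maximalIdeal_eq, Ideal.span_singleton_pow, Ideal.mem_span_singleton]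
  exact (pow_dvd_pow ϖ (by exact_mod_cast h)).mul_left r

lemma exists_mem_maximalIdeal_pow_mul_eq [IsFractionRing R K] {i j k : ℕ} (hijk : i + k = j + 1)
    {a c : K} (hac : ¬∃ e ∈ maximalIdeal R ^ i, c = algebraMap R K e * a) {w : R}
    (hw : w ∈ maximalIdeal R ^ j) :
    ∃ u ∈ maximalIdeal R ^ k, algebraMap R K u * c = algebraMap R K w * a := by
  have hc : c ≠ 0 := by
    rintro rfl
    exact hac ⟨0, zero_mem _, by simp⟩
  rcases eq_or_ne a 0 with rfl | ha
  · exact ⟨0, zero_mem _, by simp⟩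
  obtain ⟨ϖ, hϖ⟩ := IsDiscreteValuationRing.exists_irreducible R
  have hϖ0 : algebraMap R K ϖ ≠ 0 := by simpa using hϖ.ne_zero
  obtain ⟨n, v, hv⟩ := IsDiscreteValuationRing.exists_units_eq_smul_zpow_of_irreducible hϖ
    (div_ne_zero hc ha)
  rw [Units.smul_def, Algebra.smul_def, div_eq_iff ha] at hv
  have hn : n < i := by
    by_contra! h
    obtain ⟨e, he, hev⟩ := exists_mem_maximalIdeal_pow_algebraMap_eq (K := K) hϖ h v
    exact hac ⟨e, he, by rw [hev, hv]⟩
  rw [hϖ.maximalIdeal_eq, Ideal.span_singleton_pow, Ideal.mem_span_singleton] at hw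
  obtain ⟨w, rfl⟩ := hw
  obtain ⟨u, hu, huv⟩ := exists_mem_maximalIdeal_pow_algebraMap_eq (K := K) hϖ
    (show (k : ℤ) ≤ j - n by omega) (w * ↑v⁻¹)
  have hvv : algebraMap R K ↑v⁻¹ * algebraMap R K v = 1 := by
    rw [← map_mul, Units.inv_mul, map_one]
  refine ⟨u, hu, ?_⟩
  rw [huv, hv, map_mul, map_mul, map_pow, zpow_sub₀ hϖ0, zpow_natCast]
  field_simp
  linear_combination algebraMap R K w * hvv

end DiscreteValuationRing

section Characters

variable {F : Type*} [Field F] [ValuativeRel F]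

lemma unitsIncl_injective : Function.Injective (unitsIncl F) :=
  Units.map_injective Subtype.val_injective

variable [TopologicalSpace F]

lemma extZero_unitsIncl (x : 𝒪[F]ˣ →ₜ* ℂˣ) (u : 𝒪[F]ˣ) : extZero x (unitsIncl F u) = x u := by
  have h : ∃ v : 𝒪[F]ˣ, ((v : 𝒪[F]) : F) = unitsIncl F u := ⟨u, rfl⟩
  rw [extZero, dif_pos h, show h.choose = u from Units.ext (Subtype.ext h.choose_spec)]

variable [IsNonarchimedeanLocalField F]

lemma exists_eq_unitsIncl_mul_zpow {ϖ : 𝒪[F]} (hϖ : Irreducible ϖ) (a : Fˣ) :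
    ∃ (u : 𝒪[F]ˣ) (n : ℤ), a = unitsIncl F u * unif ϖ hϖ ^ n := by
  obtain ⟨n, u, h⟩ :=
    IsDiscreteValuationRing.exists_units_eq_smul_zpow_of_irreducible hϖ a.ne_zero
  refine ⟨u, n, Units.ext ?_⟩
  rw [h, Units.val_mul, Units.val_zpow_eq_zpow_val]
  rfl

/-- The normalized valuation as a homomorphism. -/
def valHom : Fˣ →* Multiplicative ℤ where
  toFun a := Multiplicative.ofAdd (val a)
  map_one' := by simp [val]
  map_mul' a b := by
    rw [← ofAdd_add]
    simp only [val, Units.val_mul, map_mul]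
    rw [WithZero.log_mul (by simp) (by simp), neg_add]

lemma val_mul (a b : Fˣ) : val (a * b) = val a + val b :=
  map_mul valHom a b

lemma val_zpow (a : Fˣ) (n : ℤ) : val (a ^ n) = n * val a :=
  congrArg Multiplicative.toAdd (map_zpow valHom a n)

lemma val_nonneg_of_mem {a : Fˣ} (ha : (a : F) ∈ 𝒪[F]) : 0 ≤ val a := by
  have h := (map_le_map_iff (IsNonarchimedeanLocalField.valueGroupWithZeroIsoInt F)).2
    (show ValuativeRel.valuation F a ≤ 1 from ha)
  rw [map_one, ← WithZero.log_le_log (by simp) (by simp), WithZero.log_one] at h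
  exact neg_nonneg.2 h

lemma val_unitsIncl (u : 𝒪[F]ˣ) : val (unitsIncl F u) = 0 := by
  have h := val_mul (unitsIncl F u) (unitsIncl F u⁻¹)
  rw [← map_mul, mul_inv_cancel, map_one, show val (1 : Fˣ) = 0 by simp [val]] at h
  have hu : 0 ≤ val (unitsIncl F u) := val_nonneg_of_mem u.1.2
  have hu' : 0 ≤ val (unitsIncl F u⁻¹) := val_nonneg_of_mem u⁻¹.1.2
  omega

lemma exists_val_eq_one : ∃ a : Fˣ, val a = 1 := by
  obtain ⟨γ, hγ⟩ := (IsNonarchimedeanLocalField.valueGroupWithZeroIsoInt F).surjective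
    (WithZero.exp (-1))
  obtain ⟨a, rfl⟩ := ValuativeRel.valuation_surjective γ
  have ha : a ≠ 0 := by
    rintro rfl
    rw [map_zero] at hγ
    exact WithZero.exp_ne_zero (hγ.symm.trans (map_zero _))
  have hlog := congrArg WithZero.log hγ
  rw [WithZero.log_exp] at hlog
  exact ⟨Units.mk0 a ha, neg_eq_iff_eq_neg.2 hlog⟩

lemma val_unif {ϖ : 𝒪[F]} (hϖ : Irreducible ϖ) : val (unif ϖ hϖ) = 1 := by
  obtain ⟨a, ha⟩ := exists_val_eq_one (F := F)
  obtain ⟨u, n, rfl⟩ := exists_eq_unitsIncl_mul_zpow hϖ a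
  rw [val_mul, val_unitsIncl, val_zpow, zero_add] at ha
  have hnonneg : 0 ≤ val (unif ϖ hϖ) := val_nonneg_of_mem ϖ.2
  rcases Int.eq_one_or_neg_one_of_mul_eq_one' ha with h | h <;> omega

/-- The decomposition `Fˣ = 𝒪ˣ × ϖ^ℤ`. -/
def unitsMulZPowersEquiv {ϖ : 𝒪[F]} (hϖ : Irreducible ϖ) : 𝒪[F]ˣ × Multiplicative ℤ ≃* Fˣ :=
  MulEquiv.ofBijective ((unitsIncl F).coprod (zpowersHom Fˣ (unif ϖ hϖ))) <| by
    refine ⟨(injective_iff_map_eq_one _).2 ?_, fun a => ?_⟩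
    · rintro ⟨u, n⟩ h
      rw [MonoidHom.coprod_apply, zpowersHom_apply] at h
      have hn := congrArg val h
      rw [val_mul, val_unitsIncl, val_zpow, val_unif, zero_add, mul_one,
        show val (1 : Fˣ) = 0 by simp [val], toAdd_eq_zero] at hn
      rw [hn, toAdd_one, zpow_zero, mul_one] at h
      exact Prod.ext (unitsIncl_injective (h.trans (map_one _).symm)) hn
    · obtain ⟨u, n, rfl⟩ := exists_eq_unitsIncl_mul_zpow hϖ a
      exact ⟨(u, Multiplicative.ofAdd n), rfl⟩

lemma unitsMulZPowersEquiv_apply {ϖ : 𝒪[F]} (hϖ : Irreducible ϖ) (p : 𝒪[F]ˣ × Multiplicative ℤ) :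
    unitsMulZPowersEquiv hϖ p = unitsIncl F p.1 * unif ϖ hϖ ^ p.2.toAdd := rfl

lemma unitsMulZPowersEquiv_symm_unitsIncl {ϖ : 𝒪[F]} (hϖ : Irreducible ϖ) (u : 𝒪[F]ˣ) :
    (unitsMulZPowersEquiv hϖ).symm (unitsIncl F u) = (u, 1) := by
  rw [MulEquiv.symm_apply_eq, unitsMulZPowersEquiv_apply]
  simp

lemma unitsMulZPowersEquiv_symm_unif {ϖ : 𝒪[F]} (hϖ : Irreducible ϖ) :
    (unitsMulZPowersEquiv hϖ).symm (unif ϖ hϖ) = (1, Multiplicative.ofAdd 1) := by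
  rw [MulEquiv.symm_apply_eq, unitsMulZPowersEquiv_apply]
  simp

lemma isOpenMap_unitsIncl : IsOpenMap (unitsIncl F) :=
  Units.isOpenMap_map Subtype.val_injective
    (ValuativeRel.valuation F).isOpen_integer.isOpenEmbedding_subtypeVal.isOpenMap

lemma continuous_of_continuous_comp_unitsIncl {G : Type*} [Group G] [TopologicalSpace G]
    [IsTopologicalGroup G] {θ : Fˣ →* G} (h : Continuous fun u => θ (unitsIncl F u)) :
    Continuous θ := by
  refine continuous_of_continuousAt_one θ ?_
  have hmap : nhds (1 : Fˣ) ≤ Filter.map (unitsIncl F) (nhds 1) := by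
    simpa using isOpenMap_unitsIncl.nhds_le (1 : 𝒪[F]ˣ)
  have hcont := h.tendsto 1
  rw [map_one] at hcont
  exact (Filter.tendsto_map'_iff.2 hcont).mono_left hmap

lemma bijective_apply_unif {ϖ : 𝒪[F]} (hϖ : Irreducible ϖ) (x : 𝒪[F]ˣ →ₜ* ℂˣ) :
    Function.Bijective (fun θ : Theta x => θ.1 (unif ϖ hϖ)) := by
  refine ⟨fun θ θ' (h : θ.1 _ = θ'.1 _) => Subtype.ext (ContinuousMonoidHom.ext fun a => ?_),
    fun z => ?_⟩
  · obtain ⟨u, n, rfl⟩ := exists_eq_unitsIncl_mul_zpow hϖ a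
    simp only [map_mul, map_zpow, θ.2, θ'.2, h]
  · let θ : Fˣ →* ℂˣ := (x.toMonoidHom.coprod (zpowersHom ℂˣ z)).comp
      (unitsMulZPowersEquiv hϖ).symm.toMonoidHom
    have hθ (u : 𝒪[F]ˣ) : θ (unitsIncl F u) = x u := by
      simp [θ, unitsMulZPowersEquiv_symm_unitsIncl]
    have hcont : Continuous θ :=
      continuous_of_continuous_comp_unitsIncl (x.continuous_toFun.congr fun u => (hθ u).symm)
    have hθϖ : θ (unif ϖ hϖ) = z := by simp [θ, unitsMulZPowersEquiv_symm_unif]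
    exact ⟨⟨⟨θ, hcont⟩, hθ⟩, hθϖ⟩

lemma card_residueField_pos : (0 : ℝ) < Nat.card 𝓀[F] := by
  exact_mod_cast Nat.card_pos

lemma normAbs_pos (a : Fˣ) : 0 < normAbs a :=
  zpow_pos card_residueField_pos _

lemma normAbs_mul (a b : Fˣ) : normAbs (a * b) = normAbs a * normAbs b := by
  rw [normAbs, val_mul, neg_add, zpow_add₀ card_residueField_pos.ne', normAbs, normAbs]

lemma normAbs_unitsIncl (u : 𝒪[F]ˣ) : normAbs (unitsIncl F u) = 1 := by
  simp [normAbs, val_unitsIncl]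

/-- The character `a ↦ ‖a‖ ^ (1 / 2)`. -/
def sqrtNormAbsHom : Fˣ →* ℂˣ :=
  MonoidHom.toHomUnits
    { toFun a := (Real.sqrt (normAbs a) : ℂ)
      map_one' := by simp [normAbs, val]
      map_mul' a b := by rw [normAbs_mul, Real.sqrt_mul (normAbs_pos a).le, Complex.ofReal_mul] }

/-- The character `a ↦ θ(a) ‖a‖ ^ (1 / 2)`, by which the Borel subgroup acts on `R_θ`, extended by
`0` to `F`. -/
def chi (θ : Fˣ →ₜ* ℂˣ) : MulChar F ℂ :=
  MulChar.ofUnitHom (θ.toMonoidHom * sqrtNormAbsHom)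

lemma chi_coe (θ : Fˣ →ₜ* ℂˣ) (a : Fˣ) : chi θ a = θ a * (Real.sqrt (normAbs a) : ℂ) := by
  rw [chi, MulChar.ofUnitHom_coe]
  rfl

lemma chi_unitsIncl {x : 𝒪[F]ˣ →ₜ* ℂˣ} (θ : Theta x) (u : 𝒪[F]ˣ) :
    chi θ.1 (unitsIncl F u) = x u := by
  rw [chi_coe, θ.2, normAbs_unitsIncl, Real.sqrt_one, Complex.ofReal_one, mul_one]

end Characters

/-! ### Matrices in `PGL(2, F)` -/

section DoubleCosets

variable {G : Type*} [Group G] {H K : Subgroup G} {a h g : G}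

lemma mul_mem_doubleCoset_iff_left (hh : h ∈ H) :
    h * g ∈ DoubleCoset.doubleCoset a H K ↔ g ∈ DoubleCoset.doubleCoset a H K := by
  have key {h g : G} (hh : h ∈ H) (hg : g ∈ DoubleCoset.doubleCoset a H K) :
      h * g ∈ DoubleCoset.doubleCoset a H K := by
    obtain ⟨y, hy, k, hk, rfl⟩ := DoubleCoset.mem_doubleCoset.1 hg
    exact DoubleCoset.mem_doubleCoset.2 ⟨h * y, H.mul_mem hh hy, k, hk, by group⟩
  exact ⟨fun hg => by simpa using key (H.inv_mem hh) hg, key hh⟩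

lemma mul_mem_doubleCoset_iff_right (hh : h ∈ K) :
    g * h ∈ DoubleCoset.doubleCoset a H K ↔ g ∈ DoubleCoset.doubleCoset a H K := by
  have key {h g : G} (hh : h ∈ K) (hg : g ∈ DoubleCoset.doubleCoset a H K) :
      g * h ∈ DoubleCoset.doubleCoset a H K := by
    obtain ⟨y, hy, k, hk, rfl⟩ := DoubleCoset.mem_doubleCoset.1 hg
    exact DoubleCoset.mem_doubleCoset.2 ⟨y, hy, k * h, K.mul_mem hk hh, by group⟩
  exact ⟨fun hg => by simpa using key (K.inv_mem hh) hg, key hh⟩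

end DoubleCosets

section Matrices

variable {F : Type*} [Field F]

/-- The lower triangular matrix with diagonal `a, b` and lower left entry `w`. -/
def lowerTri (a b : Fˣ) (w : F) : GL (Fin 2) F :=
  Matrix.GeneralLinearGroup.mkOfDetNeZero !![(a : F), 0; w, (b : F)] (by simp)

lemma GL_mul_apply {R : Type*} [CommRing R] (m n : GL (Fin 2) R) (i j : Fin 2) :
    (m * n) i j = m i 0 * n 0 j + m i 1 * n 1 j := by
  rw [Units.val_mul, Matrix.mul_apply, Fin.sum_univ_two]

lemma glTwo_ext {m n : GL (Fin 2) F} (h00 : m 0 0 = n 0 0) (h01 : m 0 1 = n 0 1)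
    (h10 : m 1 0 = n 1 0) (h11 : m 1 1 = n 1 1) : m = n := by
  refine Matrix.GeneralLinearGroup.ext fun i j => ?_
  fin_cases i <;> fin_cases j <;> assumption

lemma upperTri_one : upperTri (1 : Fˣ) 1 0 = 1 := by
  apply glTwo_ext <;> simp [upperTri]

lemma upperTri_mul (a b a' b' : Fˣ) (u u' : F) :
    upperTri a b u * upperTri a' b' u' = upperTri (a * a') (b * b') (a * u' + u * b') := by
  apply glTwo_ext <;> simp [GL_mul_apply, upperTri]

lemma det_ne_zero (m : GL (Fin 2) F) : m 0 0 * m 1 1 - m 0 1 * m 1 0 ≠ 0 := by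
  rw [← Matrix.det_fin_two]
  exact m.det.ne_zero

lemma ratio_mk (m : GL (Fin 2) F) : ratio (mk m) = m 0 0 ^ 2 / m.det := rfl

lemma ratio_mk_upperTri (a b : Fˣ) (u : F) : ratio (mk (upperTri a b u)) = ((a / b : Fˣ) : F) := by
  simp [ratio_mk, upperTri, pow_two, mul_div_mul_left]

lemma ratio_mk_lowerTri (a b : Fˣ) (w : F) : ratio (mk (lowerTri a b w)) = ((a / b : Fˣ) : F) := by
  simp [ratio_mk, lowerTri, pow_two, mul_div_mul_left]

lemma ratio_one : ratio (1 : PGL(2, F)) = 1 := by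
  rw [← map_one mk, ratio_mk]
  simp

lemma ratio_mul_upperTri (g : PGL(2, F)) (a b : Fˣ) (u : F) :
    ratio (g * mk (upperTri a b u)) = ((a / b : Fˣ) : F) * ratio g := by
  obtain ⟨m, rfl⟩ := Matrix.ProjGenLinGroup.mk_surjective g
  have hm := m.det.ne_zero
  have hentry : (m * upperTri a b u) 0 0 = m 0 0 * a := by simp [GL_mul_apply, upperTri]
  rw [← map_mul, ratio_mk, ratio_mk, hentry, map_mul, Units.val_mul,
    show ((upperTri a b u).det : F) = a * b by simp [upperTri], Units.val_div_eq_div_val]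
  field_simp

lemma ratio_diag_mul (a b : Fˣ) (g : PGL(2, F)) :
    ratio (mk (upperTri a b 0) * g) = ((a / b : Fˣ) : F) * ratio g := by
  obtain ⟨m, rfl⟩ := Matrix.ProjGenLinGroup.mk_surjective g
  have hm := m.det.ne_zero
  have hentry : (upperTri a b 0 * m) 0 0 = a * m 0 0 := by simp [GL_mul_apply, upperTri]
  rw [← map_mul, ratio_mk, ratio_mk, hentry, map_mul, Units.val_mul,
    show ((upperTri a b 0).det : F) = a * b by simp [upperTri], Units.val_div_eq_div_val]
  field_simp

lemma upperTri_mul_eq_mul_upperTri {m : GL (Fin 2) F} (hm : m 1 0 ≠ 0) {y : Fˣ} {u u' : F}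
    (hu : u * m 1 0 = (1 - y) * m 0 0) (hu' : u' * m 1 0 = (1 - y) * m 1 1) :
    upperTri y 1 u * m = m * upperTri 1 y u' := by
  have h01 : u * m 1 1 = m 0 0 * u' := by
    apply mul_right_cancel₀ hm
    linear_combination m 1 1 * hu - m 0 0 * hu'
  apply glTwo_ext <;> simp [GL_mul_apply, upperTri]
  · linear_combination hu
  · linear_combination h01
  · linear_combination -hu'

lemma lowerTri_mul_eq_mul_lowerTri {m : GL (Fin 2) F} (hm : m 0 1 ≠ 0) {y : Fˣ} {v v' : F}
    (hv : v * m 0 1 = (1 - y) * m 1 1) (hv' : v' * m 0 1 = (1 - y) * m 0 0) :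
    lowerTri 1 y v * m = m * lowerTri y 1 v' := by
  have h10 : v * m 0 0 = m 1 1 * v' := by
    apply mul_right_cancel₀ hm
    linear_combination m 0 0 * hv - m 1 1 * hv'
  apply glTwo_ext <;> simp [GL_mul_apply, lowerTri]
  · linear_combination -hv'
  · linear_combination h10
  · linear_combination hv

/-- The image in `PGL(2, F)` of the upper triangular matrices. -/
def borel (F : Type*) [Field F] : Subgroup PGL(2, F) where
  carrier := {g | ∃ a b u, g = mk (upperTri a b u)}
  one_mem' := ⟨1, 1, 0, by rw [upperTri_one, map_one]⟩
  mul_mem' := by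
    rintro _ _ ⟨a, b, u, rfl⟩ ⟨a', b', u', rfl⟩
    exact ⟨_, _, _, by rw [← map_mul, upperTri_mul]⟩
  inv_mem' := by
    rintro _ ⟨a, b, u, rfl⟩
    refine ⟨a⁻¹, b⁻¹, -(a⁻¹ * (u * b⁻¹) : F), inv_eq_of_mul_eq_one_right ?_⟩
    rw [← map_mul, upperTri_mul, mul_inv_cancel, mul_inv_cancel, ← map_one mk, ← upperTri_one]
    congr 2
    simp

lemma mk_upperTri_mem_borel (a b : Fˣ) (u : F) : mk (upperTri a b u) ∈ borel F :=
  ⟨a, b, u, rfl⟩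

lemma mk_eq_lowerTri_mul_upperTri {m : GL (Fin 2) F} {e : F} (h : m 1 0 = e * m 0 0) :
    ∃ a b : Fˣ, m = lowerTri 1 1 e * upperTri a b (m 0 1) := by
  have hdet : m 0 0 * (m 1 1 - e * m 0 1) ≠ 0 := by
    convert det_ne_zero m using 1
    rw [h]
    ring
  refine ⟨Units.mk0 _ (left_ne_zero_of_mul hdet), Units.mk0 _ (right_ne_zero_of_mul hdet), ?_⟩
  apply glTwo_ext <;> simp [GL_mul_apply, lowerTri, upperTri, h]

end Matrices

/-! ### The group `Γ_d` and its character -/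

section Gamma

variable {F : Type*} [Field F] [ValuativeRel F]

lemma ratio_intToPGL {k : GL (Fin 2) 𝒪[F]} {p : 𝒪[F]ˣ} (hp : (p : 𝒪[F]) = k 0 0) :
    ratio (intToPGL k) = unitsIncl F (p ^ 2 / k.det) := by
  have hk : ratio (intToPGL k) = ((k 0 0 : 𝒪[F]) : F) ^ 2 /
    (Matrix.GeneralLinearGroup.map (Subring.subtype 𝒪[F]) k).det := rfl
  rw [hk, Matrix.GeneralLinearGroup.map_det, ← hp, map_div, map_pow, Units.val_div_eq_div_val,
    Units.val_pow_eq_pow_val]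
  rfl

variable [TopologicalSpace F] {x : 𝒪[F]ˣ →ₜ* ℂˣ}

lemma xTilde_mk_upperTri (u v : 𝒪[F]ˣ) (w : F) :
    xTilde x (mk (upperTri (unitsIncl F u) (unitsIncl F v) w)) = x (u / v) := by
  rw [xTilde, ratio_mk_upperTri, ← map_div, extZero_unitsIncl]

lemma xTilde_mk_lowerTri (u v : 𝒪[F]ˣ) (w : F) :
    xTilde x (mk (lowerTri (unitsIncl F u) (unitsIncl F v) w)) = x (u / v) := by
  rw [xTilde, ratio_mk_lowerTri, ← map_div, extZero_unitsIncl]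

lemma xTilde_one : xTilde x 1 = 1 := by
  rw [xTilde, ratio_one, ← Units.val_one, ← map_one (unitsIncl F), extZero_unitsIncl, map_one,
    Units.val_one]

variable [IsNonarchimedeanLocalField F]

lemma mk_mem_Gamma {d : ℕ} {m : GL (Fin 2) F} {A : Matrix (Fin 2) (Fin 2) 𝒪[F]}
    (hA : IsUnit A.det) (hA10 : A 1 0 ∈ 𝓂[F] ^ d) (h : ∀ i j, m i j = A i j) : mk m ∈ Gamma F d :=
  ⟨Matrix.GeneralLinearGroup.mk'' A hA, hA10,
    congrArg mk (Matrix.GeneralLinearGroup.ext fun i j => (h i j).symm)⟩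

lemma mk_upperTri_mem_Gamma (d : ℕ) (u v : 𝒪[F]ˣ) (w : 𝒪[F]) :
    mk (upperTri (unitsIncl F u) (unitsIncl F v) w) ∈ Gamma F d := by
  refine mk_mem_Gamma (A := !![(u : 𝒪[F]), w; 0, v]) (by simp) (by simp) fun i j => ?_
  fin_cases i <;> fin_cases j <;> simp [upperTri, unitsIncl]

lemma mk_lowerTri_mem_Gamma {d : ℕ} (u v : 𝒪[F]ˣ) {w : 𝒪[F]} (hw : w ∈ 𝓂[F] ^ d) :
    mk (lowerTri (unitsIncl F u) (unitsIncl F v) w) ∈ Gamma F d := by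
  refine mk_mem_Gamma (A := !![(u : 𝒪[F]), 0; w, v]) (by simp) (by simpa using hw) fun i j => ?_
  fin_cases i <;> fin_cases j <;> simp [lowerTri, unitsIncl]

lemma isUnit_apply_zero_zero {d : ℕ} (hd : 0 < d) {k : GL (Fin 2) 𝒪[F]}
    (hk : k ∈ GammaTilde F d) : IsUnit (k 0 0) := by
  have hk10 : k 1 0 ∈ 𝓂[F] := Ideal.pow_le_self hd.ne' hk
  have hdet : IsUnit (k 0 0 * k 1 1 - k 0 1 * k 1 0) := by
    rw [← Matrix.det_fin_two]
    exact k.det.isUnit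
  rw [sub_eq_add_neg] at hdet
  refine (IsLocalRing.isUnit_or_isUnit_of_isUnit_add hdet).elim isUnit_of_mul_isUnit_left
    fun h => absurd (isUnit_of_mul_isUnit_right (neg_mul_eq_neg_mul (k 0 1) (k 1 0) ▸ h)) ?_
  exact (IsLocalRing.mem_maximalIdeal _).1 hk10

lemma xTilde_mul (hx : x ^ 2 ≠ 1) {γ γ' : PGL(2, F)} (hγ : γ ∈ Gamma F (depth x))
    (hγ' : γ' ∈ Gamma F (depth x)) : xTilde x (γ * γ') = xTilde x γ * xTilde x γ' := by
  obtain ⟨k, hk, rfl⟩ := hγ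
  obtain ⟨l, hl, rfl⟩ := hγ'
  obtain ⟨p, hp⟩ := isUnit_apply_zero_zero (depth_pos hx) hk
  obtain ⟨q, hq⟩ := isUnit_apply_zero_zero (depth_pos hx) hl
  obtain ⟨s, hs⟩ := isUnit_apply_zero_zero (depth_pos hx) (mul_mem hk hl)
  -- `s = pq + k₁₂ l₂₁`, so `s ≡ pq` modulo `𝓂 ^ d`, and `x ^ 2` does not distinguish them
  have hsq : x (s / (p * q)) ^ 2 = 1 := by
    refine sq_eq_one_of_sub_one_mem x ?_
    have hdiv : ((s / (p * q) : 𝒪[F]ˣ) : 𝒪[F]) - 1 = ↑(p * q)⁻¹ * (k 0 1) * l 1 0 := by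
      rw [← (p * q).isUnit.mul_right_inj, mul_sub, ← Units.val_mul, mul_div_cancel, mul_assoc,
        Units.mul_inv_cancel_left, mul_one, hs, GL_mul_apply, Units.val_mul, hp, hq,
        add_sub_cancel_left]
    rw [hdiv]
    exact Ideal.mul_mem_left _ _ hl
  rw [← map_mul, xTilde, xTilde, xTilde, ratio_intToPGL hs, ratio_intToPGL hp, ratio_intToPGL hq,
    extZero_unitsIncl, extZero_unitsIncl, extZero_unitsIncl, ← Units.val_mul, ← map_mul x,
    show s ^ 2 / (k * l).det = (p ^ 2 / k.det * (q ^ 2 / l.det)) * (s / (p * q)) ^ 2 by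
      rw [map_mul, div_mul_div_comm, ← mul_pow, div_pow, div_mul_div_comm,
        mul_comm _ ((p * q) ^ 2), mul_div_mul_left_eq_div],
    map_mul x, map_pow, hsq, mul_one]

lemma xTilde_mul_xTilde_inv (hx : x ^ 2 ≠ 1) {γ : PGL(2, F)} (hγ : γ ∈ Gamma F (depth x)) :
    xTilde x γ * xTilde x γ⁻¹ = 1 := by
  rw [← xTilde_mul hx hγ (inv_mem hγ), mul_inv_cancel, xTilde_one]

lemma chi_ratio (hx : x ^ 2 ≠ 1) (θ : Theta x) {γ : PGL(2, F)} (hγ : γ ∈ Gamma F (depth x)) :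
    chi θ.1 (ratio γ) = xTilde x γ := by
  obtain ⟨k, hk, rfl⟩ := hγ
  obtain ⟨p, hp⟩ := isUnit_apply_zero_zero (depth_pos hx) hk
  rw [xTilde, ratio_intToPGL hp, chi_unitsIncl, extZero_unitsIncl]

variable (F) in
/-- The open cell `Γ_d B`, where `B` is the image of the upper triangular matrices. -/
def cell (d : ℕ) : Set PGL(2, F) :=
  DoubleCoset.doubleCoset 1 (Gamma F d) (borel F)

end Gamma

/-! ### Functions equivariant under `Γ_d` -/

section Equivariant

variable {F : Type*} [Field F] [ValuativeRel F] [TopologicalSpace F] [IsNonarchimedeanLocalField F]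

lemma isOpenMap_intToPGL : IsOpenMap (intToPGL (F := F)) := by
  have hval : IsOpenMap (Subtype.val : 𝒪[F] → F) :=
    (ValuativeRel.valuation F).isOpen_integer.isOpenEmbedding_subtypeVal.isOpenMap
  have hmatrix : IsOpenMap fun A : Matrix (Fin 2) (Fin 2) 𝒪[F] => A.map Subtype.val :=
    IsOpenMap.piMap (fun _ => IsOpenMap.piMap (fun _ => hval) (Set.toFinite _)) (Set.toFinite _)
  exact (QuotientGroup.isOpenMap_coe (N := Subgroup.center (GL (Fin 2) F))).comp
    (Units.isOpenMap_map (Matrix.map_injective Subtype.val_injective) hmatrix)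

lemma isOpen_GammaTilde (d : ℕ) : IsOpen (GammaTilde F d : Set (GL (Fin 2) 𝒪[F])) :=
  (IsLocalRing.isOpen_maximalIdeal_pow 𝒪[F] d).preimage
    (Units.continuous_val.matrix_elem 1 0)

lemma isOpen_Gamma (d : ℕ) : IsOpen (Gamma F d : Set PGL(2, F)) :=
  isOpenMap_intToPGL _ (isOpen_GammaTilde d)

lemma isCompact_Gamma (d : ℕ) : IsCompact (Gamma F d : Set PGL(2, F)) := by
  have : CompactSpace (Matrix (Fin 2) (Fin 2) 𝒪[F]) :=
    inferInstanceAs (CompactSpace (Fin 2 → Fin 2 → 𝒪[F]))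
  have hcont : Continuous (intToPGL (F := F)) :=
    (QuotientGroup.continuous_mk (N := Subgroup.center (GL (Fin 2) F))).comp
      (Continuous.units_map _ (continuous_id.matrix_map continuous_subtype_val))
  exact ((GammaTilde F d).isClosed_of_isOpen (isOpen_GammaTilde d)).isCompact.image hcont

variable {x : 𝒪[F]ˣ →ₜ* ℂˣ}

lemma eventually_xTilde_eq_one (hx : x ^ 2 ≠ 1) : ∀ᶠ g in nhds (1 : PGL(2, F)), xTilde x g = 1 := by
  obtain ⟨r, hr⟩ := exists_forall_sub_one_mem_pow_imp_eq_one x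
  have hopen := IsLocalRing.isOpen_maximalIdeal_pow 𝒪[F] r
  have h00 : ∀ᶠ k in nhds (1 : GL (Fin 2) 𝒪[F]), k 0 0 - 1 ∈ 𝓂[F] ^ r :=
    (hopen.preimage ((Units.continuous_val.matrix_elem 0 0).sub continuous_const)).mem_nhds
      (by simp)
  have hdet : ∀ᶠ k in nhds (1 : GL (Fin 2) 𝒪[F]),
      (k.det : 𝒪[F]) - 1 ∈ 𝓂[F] ^ r :=
    (hopen.preimage ((Continuous.matrix_det Units.continuous_val).sub continuous_const)).mem_nhds
      (by simp)
  have hGamma : ∀ᶠ k in nhds (1 : GL (Fin 2) 𝒪[F]), k ∈ GammaTilde F (depth x) :=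
    (isOpen_GammaTilde (depth x)).mem_nhds (one_mem _)
  have hle := isOpenMap_intToPGL (F := F).nhds_le 1
  rw [map_one] at hle
  refine hle (Filter.mem_map.2 ?_)
  filter_upwards [h00, hdet, hGamma] with k hk00 hkdet hk
  obtain ⟨p, hp⟩ := isUnit_apply_zero_zero (depth_pos hx) hk
  rw [Set.mem_preimage, Set.mem_ofPred_eq, xTilde, ratio_intToPGL hp, extZero_unitsIncl, map_div,
    map_pow, hr p (hp ▸ hk00), hr k.det hkdet]
  simp

/-- The functions on which left translation by `γ ∈ Γ_d`, `d = d(x)`, is multiplication by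
`x̃(γ)`. -/
def IsLeftEquivariant (x : 𝒪[F]ˣ →ₜ* ℂˣ) (f : PGL(2, F) → ℂ) : Prop :=
  ∀ γ ∈ Gamma F (depth x), ∀ g, f (γ * g) = xTilde x γ * f g

lemma isLeftEquivariant_of_mem_heckeX {f : PGL(2, F) → ℂ} (hf : f ∈ heckeX x) :
    IsLeftEquivariant x f :=
  fun γ hγ g => (hf.2 γ hγ g).1

lemma IsLeftEquivariant.isLocallyConstant (hx : x ^ 2 ≠ 1) {f : PGL(2, F) → ℂ}
    (hf : IsLeftEquivariant x f) : IsLocallyConstant f := by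
  refine (IsLocallyConstant.iff_eventually_eq _).2 fun g => ?_
  have htendsto : Filter.Tendsto (fun g' : PGL(2, F) => g' * g⁻¹) (nhds g) (nhds 1) := by
    simpa using (continuous_mul_const (g⁻¹ : PGL(2, F))).tendsto g
  have hGamma := (isOpen_Gamma (F := F) (depth x)).mem_nhds (one_mem _)
  filter_upwards [htendsto.eventually hGamma, htendsto.eventually (eventually_xTilde_eq_one hx)]
    with g' hg' hone
  simpa [hone] using hf _ hg' g

end Equivariant

/-! ### The functions `φ_n` -/

section Phi

section Field

variable {F : Type*} [Field F]

/-- The embedding of `Fˣ` in `PGL(2, F)` as the diagonal matrices with entries `1, a`. -/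
def diagHom : Fˣ →* PGL(2, F) where
  toFun a := mk (upperTri 1 a 0)
  map_one' := by rw [upperTri_one, map_one]
  map_mul' a b := by
    rw [← map_mul, upperTri_mul, mul_one, mul_zero, zero_mul, add_zero]

lemma ratio_diagHom_mul (a : Fˣ) (g : PGL(2, F)) :
    ratio (diagHom a * g) = ((a⁻¹ : Fˣ) : F) * ratio g := by
  rw [← one_div]
  exact ratio_diag_mul 1 a g

lemma ratio_mul_diagHom (g : PGL(2, F)) (a : Fˣ) :
    ratio (g * diagHom a) = ((a⁻¹ : Fˣ) : F) * ratio g := by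
  rw [← one_div]
  exact ratio_mul_upperTri g 1 a 0

lemma tElt_zpow [ValuativeRel F] {ϖ : 𝒪[F]} (hϖ : Irreducible ϖ) (n : ℤ) :
    tElt ϖ hϖ ^ n = diagHom (unif ϖ hϖ ^ n) :=
  (map_zpow diagHom (unif ϖ hϖ) n).symm

end Field

variable {F : Type*} [Field F] [ValuativeRel F] [TopologicalSpace F] [IsNonarchimedeanLocalField F]
  {x : 𝒪[F]ˣ →ₜ* ℂˣ} {ϖ : 𝒪[F]} {hϖ : Irreducible ϖ} {n : ℤ}

lemma xTilde_mul_eq_of_mul_diagHom_mul_eq (hx : x ^ 2 ≠ 1) {a : Fˣ} {α β α' β' : PGL(2, F)}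
    (hα : α ∈ Gamma F (depth x)) (hβ : β ∈ Gamma F (depth x)) (hα' : α' ∈ Gamma F (depth x))
    (hβ' : β' ∈ Gamma F (depth x)) (h : α * diagHom a * β = α' * diagHom a * β') :
    xTilde x (α * β) = xTilde x (α' * β') := by
  have hconj : α'⁻¹ * α * diagHom a = diagHom a * (β' * β⁻¹) := by
    rw [mul_assoc, inv_mul_eq_iff_eq_mul, ← mul_assoc, ← mul_assoc, ← h, mul_inv_cancel_right]
  have hratio : ratio (α'⁻¹ * α) = ratio (β' * β⁻¹) := by
    have h := congrArg ratio hconj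
    rw [ratio_mul_diagHom, ratio_diagHom_mul] at h
    exact mul_left_cancel₀ a⁻¹.ne_zero h
  have hxTilde : xTilde x α'⁻¹ * xTilde x α = xTilde x β' * xTilde x β⁻¹ := by
    rw [← xTilde_mul hx (inv_mem hα') hα, ← xTilde_mul hx hβ' (inv_mem hβ), xTilde, hratio, xTilde]
  rw [xTilde_mul hx hα hβ, xTilde_mul hx hα' hβ']
  linear_combination xTilde x α' * xTilde x β * hxTilde - xTilde x α * xTilde x β *
    xTilde_mul_xTilde_inv hx hα' + xTilde x α' * xTilde x β' * xTilde_mul_xTilde_inv hx hβ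

lemma phi_apply (hx : x ^ 2 ≠ 1) {γ γ' : PGL(2, F)} (hγ : γ ∈ Gamma F (depth x))
    (hγ' : γ' ∈ Gamma F (depth x)) :
    phi x ϖ hϖ n (γ * tElt ϖ hϖ ^ n * γ') = xTilde x (γ * γ') := by
  have h : ∃ p : Gamma F (depth x) × Gamma F (depth x),
      γ * tElt ϖ hϖ ^ n * γ' = (p.1 : PGL(2, F)) * tElt ϖ hϖ ^ n * (p.2 : PGL(2, F)) :=
    ⟨(⟨γ, hγ⟩, ⟨γ', hγ'⟩), rfl⟩
  have hspec := h.choose_spec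
  rw [phi, dif_pos h]
  generalize h.choose = p at hspec ⊢
  rw [tElt_zpow] at hspec
  exact (xTilde_mul_eq_of_mul_diagHom_mul_eq hx hγ hγ' p.1.2 p.2.2 hspec).symm

variable (hϖ n) in
/-- The double coset `Γ_d tⁿ Γ_d`. -/
def tCoset (d : ℕ) : Set PGL(2, F) :=
  DoubleCoset.doubleCoset (tElt ϖ hϖ ^ n) (Gamma F d) (Gamma F d)

lemma isOpen_tCoset (d : ℕ) : IsOpen (tCoset hϖ n d) :=
  (isOpen_Gamma d).mul_left

lemma isCompact_tCoset (d : ℕ) : IsCompact (tCoset hϖ n d) :=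
  ((isCompact_Gamma d).mul isCompact_singleton).mul (isCompact_Gamma d)

lemma phi_of_notMem_tCoset {g : PGL(2, F)} (hg : g ∉ tCoset hϖ n (depth x)) :
    phi x ϖ hϖ n g = 0 :=
  dif_neg fun ⟨p, hp⟩ => hg <| DoubleCoset.mem_doubleCoset.2 ⟨p.1, p.1.2, p.2, p.2.2, hp⟩

lemma phi_mul_left (hx : x ^ 2 ≠ 1) : IsLeftEquivariant x (phi x ϖ hϖ n) := by
  intro γ hγ g
  by_cases hg : g ∈ tCoset hϖ n (depth x)
  · obtain ⟨α, hα, β, hβ, rfl⟩ := DoubleCoset.mem_doubleCoset.1 hg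
    rw [phi_apply hx hα hβ, ← mul_assoc, ← mul_assoc, phi_apply hx (mul_mem hγ hα) hβ, mul_assoc,
      xTilde_mul hx hγ (mul_mem hα hβ)]
  · rw [phi_of_notMem_tCoset hg, mul_zero,
      phi_of_notMem_tCoset ((mul_mem_doubleCoset_iff_left hγ).not.2 hg)]

lemma phi_mul_right (hx : x ^ 2 ≠ 1) {γ : PGL(2, F)} (hγ : γ ∈ Gamma F (depth x))
    (g : PGL(2, F)) : phi x ϖ hϖ n (g * γ) = xTilde x γ * phi x ϖ hϖ n g := by
  by_cases hg : g ∈ tCoset hϖ n (depth x)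
  · obtain ⟨α, hα, β, hβ, rfl⟩ := DoubleCoset.mem_doubleCoset.1 hg
    rw [phi_apply hx hα hβ, mul_assoc (α * _), phi_apply hx hα (mul_mem hβ hγ), ← mul_assoc,
      xTilde_mul hx (mul_mem hα hβ) hγ, mul_comm]
  · rw [phi_of_notMem_tCoset hg, mul_zero,
      phi_of_notMem_tCoset ((mul_mem_doubleCoset_iff_right hγ).not.2 hg)]

lemma phi_mem_heckeX (hx : x ^ 2 ≠ 1) (hϖ : Irreducible ϖ) (n : ℤ) : phi x ϖ hϖ n ∈ heckeX x :=
  ⟨⟨(phi_mul_left hx).isLocallyConstant hx,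
    HasCompactSupport.intro (isCompact_tCoset _) fun _ hg => phi_of_notMem_tCoset hg⟩,
    fun γ hγ g => ⟨phi_mul_left hx γ hγ g, phi_mul_right hx hγ g⟩⟩

/-- The function `φ_n` as an element of the Hecke algebra. -/
def phiVec (hx : x ^ 2 ≠ 1) (hϖ : Irreducible ϖ) (n : ℤ) : heckeX x :=
  ⟨phi x ϖ hϖ n, phi_mem_heckeX hx hϖ n⟩

end Phi

/-! ### The equivariant vector of the induced representation -/

section CellVector

variable {F : Type*} [Field F] [ValuativeRel F] [TopologicalSpace F] [IsNonarchimedeanLocalField F]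
  {x : 𝒪[F]ˣ →ₜ* ℂˣ}

lemma one_mem_cell (d : ℕ) : (1 : PGL(2, F)) ∈ cell F d :=
  DoubleCoset.mem_doubleCoset.2 ⟨1, one_mem _, 1, one_mem _, by group⟩

lemma isOpen_cell (d : ℕ) : IsOpen (cell F d) :=
  (isOpen_Gamma d).mul_right.mul_right

lemma mem_cell_iff {d : ℕ} {g : PGL(2, F)} :
    g ∈ cell F d ↔ ∃ γ ∈ Gamma F d, ∃ a b u, g = γ * mk (upperTri a b u) := by
  refine DoubleCoset.mem_doubleCoset.trans ⟨?_, ?_⟩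
  · rintro ⟨γ, hγ, _, ⟨a, b, u, rfl⟩, rfl⟩
    exact ⟨γ, hγ, a, b, u, by rw [mul_one]⟩
  · rintro ⟨γ, hγ, a, b, u, rfl⟩
    exact ⟨γ, hγ, _, mk_upperTri_mem_borel a b u, by rw [mul_one]⟩

lemma mk_mem_cell {d : ℕ} {m : GL (Fin 2) F} {e : 𝒪[F]} (he : e ∈ 𝓂[F] ^ d)
    (h : m 1 0 = e * m 0 0) : mk m ∈ cell F d := by
  obtain ⟨a, b, hm⟩ := mk_eq_lowerTri_mul_upperTri h
  refine mem_cell_iff.2 ⟨_, mk_lowerTri_mem_Gamma 1 1 he, a, b, m 0 1, ?_⟩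
  rw [map_one, ← map_mul, ← hm]

open scoped Classical in
/-- The `Γ_d`-equivariant function in `R_θ` supported on the open cell `Γ_d B`, with value `1`
at `1`; both `x̃` on `Γ_d` and `θ(b̄) ‖b̄‖ ^ (1 / 2)` on `B` are given by
`chi θ (g₁₁² / det g)`. -/
def cellFun (θ : Theta x) (g : PGL(2, F)) : ℂ :=
  if g ∈ cell F (depth x) then chi θ.1 (ratio g) else 0

lemma cellFun_one (θ : Theta x) : cellFun θ 1 = 1 := by
  rw [cellFun, if_pos (one_mem_cell _), ratio_one, map_one]

lemma cellFun_mul_left (hx : x ^ 2 ≠ 1) (θ : Theta x) : IsLeftEquivariant x (cellFun θ) := by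
  intro γ hγ g
  have hiff : γ * g ∈ cell F (depth x) ↔ g ∈ cell F (depth x) := mul_mem_doubleCoset_iff_left hγ
  by_cases hg : g ∈ cell F (depth x)
  · rw [cellFun, cellFun, if_pos hg, if_pos (hiff.2 hg)]
    obtain ⟨γ', hγ', a, b, u, rfl⟩ := mem_cell_iff.1 hg
    rw [← mul_assoc, ratio_mul_upperTri, ratio_mul_upperTri, map_mul, map_mul,
      chi_ratio hx θ (mul_mem hγ hγ'), chi_ratio hx θ hγ', xTilde_mul hx hγ hγ', mul_left_comm]
  · rw [cellFun, cellFun, if_neg hg, if_neg (hiff.not.2 hg), mul_zero]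

lemma cellFun_mul_upperTri (θ : Theta x) (g : PGL(2, F)) (a b : Fˣ) (u : F) :
    cellFun θ (g * mk (upperTri a b u)) = chi θ.1 ((a / b : Fˣ) : F) * cellFun θ g := by
  have hiff : g * mk (upperTri a b u) ∈ cell F (depth x) ↔ g ∈ cell F (depth x) :=
    mul_mem_doubleCoset_iff_right (mk_upperTri_mem_borel a b u)
  by_cases hg : g ∈ cell F (depth x)
  · rw [cellFun, cellFun, if_pos hg, if_pos (hiff.2 hg), ratio_mul_upperTri, map_mul]
  · rw [cellFun, cellFun, if_neg hg, if_neg (hiff.not.2 hg), mul_zero]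

/-- The function `cellFun θ` as a vector of `R_θ`. -/
def cellVec (hx : x ^ 2 ≠ 1) (θ : Theta x) : inducedSpace θ.1 :=
  ⟨cellFun θ, (cellFun_mul_left hx θ).isLocallyConstant hx,
    fun g a b u => by rw [cellFun_mul_upperTri, chi_coe]⟩

lemma cellVec_ne_zero (hx : x ^ 2 ≠ 1) (θ : Theta x) : cellVec hx θ ≠ 0 := by
  intro h
  have h1 := congrFun (congrArg Subtype.val h) 1
  exact one_ne_zero ((cellFun_one θ).symm.trans h1)

end CellVector

section MultiplicityOne

variable {F : Type*} [Field F] [ValuativeRel F] [TopologicalSpace F] [IsNonarchimedeanLocalField F]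
  {x : 𝒪[F]ˣ →ₜ* ℂˣ} {θ : Theta x} {w : PGL(2, F) → ℂ}

lemma mul_upperTri_of_mem_inducedSpace (hw : w ∈ inducedSpace θ.1) (g : PGL(2, F)) (a b : Fˣ)
    (u : F) : w (g * mk (upperTri a b u)) = chi θ.1 ((a / b : Fˣ) : F) * w g := by
  rw [hw.2, chi_coe]

lemma apply_eq_zero_of_notMem_cell (hx : x ^ 2 ≠ 1) (hwx : IsLeftEquivariant x w)
    (hw : w ∈ inducedSpace θ.1) {g : PGL(2, F)} (hg : g ∉ cell F (depth x)) : w g = 0 := by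
  obtain ⟨m, rfl⟩ := Matrix.ProjGenLinGroup.mk_surjective g
  have hm : ¬∃ e ∈ 𝓂[F] ^ depth x, m 1 0 = e * m 0 0 :=
    fun ⟨_, he, h⟩ => hg (mk_mem_cell he h)
  have hm0 : m 1 0 ≠ 0 := fun h => hm ⟨0, zero_mem _, by simp [h]⟩
  obtain ⟨y, hy, hxy⟩ := exists_sq_ne_one hx
  rw [← neg_mem_iff, neg_sub] at hy
  obtain ⟨u, -, hu⟩ := exists_mem_maximalIdeal_pow_mul_eq (k := 0)
    (by have := depth_pos hx; omega) hm hy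
  have hγ : mk (upperTri (unitsIncl F y) 1 u) ∈ Gamma F (depth x) := by
    simpa using mk_upperTri_mem_Gamma (depth x) y 1 u
  have hcomm : mk (upperTri (unitsIncl F y) 1 u) * mk m =
      mk m * mk (upperTri 1 (unitsIncl F y) ((1 - y) * m 1 1 / m 1 0)) := by
    rw [← map_mul, upperTri_mul_eq_mul_upperTri hm0 hu (div_mul_cancel₀ _ hm0), map_mul]
    rfl
  have hxw : (x y : ℂ) * w (mk m) = ((x y)⁻¹ : ℂˣ) * w (mk m) := by
    have hleft := hwx _ hγ (mk m)
    rw [hcomm, mul_upperTri_of_mem_inducedSpace hw, ← map_one (unitsIncl F), xTilde_mk_upperTri,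
      ← map_div, chi_unitsIncl, div_one, one_div, map_inv] at hleft
    exact hleft.symm
  have hsq : ((x y : ℂ) ^ 2 - 1) * w (mk m) = 0 := by
    linear_combination (x y : ℂ) * hxw + w (mk m) * (x y).mul_inv
  refine (mul_eq_zero.1 hsq).resolve_left fun h => hxy ?_
  exact Units.ext (by simpa [sub_eq_zero] using h)

theorem eq_smul_cellVec (hx : x ^ 2 ≠ 1) {w : inducedSpace θ.1}
    (hwx : IsLeftEquivariant x (w : PGL(2, F) → ℂ)) :
    w = (w : PGL(2, F) → ℂ) 1 • cellVec hx θ := by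
  refine Subtype.ext (funext fun g => ?_)
  change (w : PGL(2, F) → ℂ) g = (w : PGL(2, F) → ℂ) 1 * cellFun θ g
  by_cases hg : g ∈ cell F (depth x)
  · obtain ⟨γ, hγ, a, b, u, rfl⟩ := mem_cell_iff.1 hg
    have hb := mul_upperTri_of_mem_inducedSpace w.2 1 a b u
    have hcell := cellFun_mul_upperTri θ 1 a b u
    rw [one_mul] at hb hcell
    rw [hwx γ hγ, cellFun_mul_left hx θ γ hγ, hb, hcell, cellFun_one]
    ring
  · rw [apply_eq_zero_of_notMem_cell hx hwx w.2 hg, cellFun, if_neg hg, mul_zero]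

end MultiplicityOne

/-! ### The action of the Hecke algebra on the equivariant vector -/

section FiniteRankTrace

variable {V : Type*} [AddCommGroup V] [Module ℂ V] {A : Module.End ℂ V} {v : V}

lemma range_le_span_singleton (hA : ∀ w, ∃ k : ℂ, A w = k • v) :
    LinearMap.range A ≤ Submodule.span ℂ {v} := by
  rintro _ ⟨w, rfl⟩
  obtain ⟨k, hk⟩ := hA w
  exact Submodule.mem_span_singleton.2 ⟨k, hk.symm⟩

lemma finRankTrace_eq {c : ℂ} (hv : v ≠ 0) (hA : ∀ w, ∃ k : ℂ, A w = k • v) (hc : A v = c • v) :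
    finRankTrace A = c := by
  have hle := range_le_span_singleton hA
  have hscalar : A.restrict (p := LinearMap.range A) (q := LinearMap.range A)
      (fun v _ => ⟨v, rfl⟩) = c • LinearMap.id := by
    ext ⟨w, hw⟩
    obtain ⟨k, rfl⟩ := Submodule.mem_span_singleton.1 (hle hw)
    change A (k • v) = c • k • v
    rw [map_smul, hc, smul_comm]
  have := Submodule.finiteDimensional_of_le hle
  rw [finRankTrace, hscalar, map_smul, LinearMap.trace_id]
  rcases eq_or_ne c 0 with rfl | hc0
  · rw [zero_smul]
  have heq : LinearMap.range A = Submodule.span ℂ {v} := by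
    refine le_antisymm hle ((Submodule.span_singleton_le_iff_mem _ _).2 ⟨c⁻¹ • v, ?_⟩)
    rw [map_smul, hc, inv_smul_smul₀ hc0]
  rw [heq, finrank_span_singleton hv, Nat.cast_one, smul_eq_mul, mul_one]

end FiniteRankTrace

section Convolution

variable {F : Type*} [Field F] [ValuativeRel F] [TopologicalSpace F] [IsNonarchimedeanLocalField F]
  [MeasurableSpace PGL(2, F)] (dg : Measure PGL(2, F)) {f h : PGL(2, F) → ℂ}

lemma hasCompactSupport_conv (hf : HasCompactSupport f) (hh : HasCompactSupport h) :
    HasCompactSupport (conv dg f h) := by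
  refine HasCompactSupport.intro (hf.isCompact.mul hh.isCompact) fun g hg => ?_
  refine integral_eq_zero_of_ae (Filter.Eventually.of_forall fun y => ?_)
  by_contra hne
  exact hg (Set.mem_mul.2 ⟨y, subset_tsupport _ (left_ne_zero_of_mul hne), y⁻¹ * g,
    subset_tsupport _ (right_ne_zero_of_mul hne), mul_inv_cancel_left y g⟩)

variable [BorelSpace PGL(2, F)]

lemma conv_assoc [dg.IsHaarMeasure] {v : PGL(2, F) → ℂ} (hf : Continuous f)
    (hfc : HasCompactSupport f) (hh : Continuous h) (hhc : HasCompactSupport h)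
    (hv : Continuous v) : conv dg (conv dg f h) v = conv dg f (conv dg h v) := by
  ext g
  have hswap : ∫ a, ∫ y, f y * h (y⁻¹ * a) * v (a⁻¹ * g) ∂dg ∂dg =
      ∫ y, ∫ a, f y * h (y⁻¹ * a) * v (a⁻¹ * g) ∂dg ∂dg := by
    refine integral_integral_swap_of_hasCompactSupport (by unfold Function.uncurry; fun_prop) ?_
    refine HasCompactSupport.intro ((hfc.isCompact.mul hhc.isCompact).prod hfc.isCompact)
      fun ⟨a, y⟩ hay => ?_
    by_contra hne
    have hfh := left_ne_zero_of_mul hne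
    have hy := subset_tsupport _ (left_ne_zero_of_mul hfh)
    exact hay ⟨Set.mem_mul.2 ⟨y, hy, y⁻¹ * a, subset_tsupport _ (right_ne_zero_of_mul hfh),
      mul_inv_cancel_left y a⟩, hy⟩
  calc conv dg (conv dg f h) v g
      = ∫ a, ∫ y, f y * h (y⁻¹ * a) * v (a⁻¹ * g) ∂dg ∂dg := by
        simp only [conv, integral_mul_const]
    _ = ∫ y, f y * ∫ a, h (y⁻¹ * a) * v (a⁻¹ * g) ∂dg ∂dg := by
        rw [hswap]
        simp only [mul_assoc, integral_const_mul]
    _ = conv dg f (conv dg h v) g := by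
        refine integral_congr_ae (Filter.Eventually.of_forall fun y => ?_)
        simp only [conv]
        rw [← integral_mul_left_eq_self _ y]
        simp only [mul_inv_rev, inv_mul_cancel_left, mul_assoc]

variable {x : 𝒪[F]ˣ →ₜ* ℂˣ} [dg.IsHaarMeasure]

lemma IsLeftEquivariant.conv (hf : IsLeftEquivariant x f) (v : PGL(2, F) → ℂ) :
    IsLeftEquivariant x (conv dg f v) := by
  intro γ hγ g
  rw [PGL2Hecke.conv, PGL2Hecke.conv, ← integral_mul_left_eq_self _ γ, ← integral_const_mul]
  refine integral_congr_ae (Filter.Eventually.of_forall fun y => ?_)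
  simp only [hf γ hγ y, mul_inv_rev, mul_assoc, inv_mul_cancel_left]

lemma conv_mem_heckeX (hx : x ^ 2 ≠ 1) (f h : heckeX x) : conv dg f h ∈ heckeX x := by
  have hleft := (isLeftEquivariant_of_mem_heckeX f.2).conv dg h
  refine ⟨⟨hleft.isLocallyConstant hx, hasCompactSupport_conv dg f.2.1.2 h.2.1.2⟩,
    fun γ hγ g => ⟨hleft γ hγ g, ?_⟩⟩
  rw [conv, conv, ← integral_const_mul]
  refine integral_congr_ae (Filter.Eventually.of_forall fun y => ?_)
  simp only [← mul_assoc, (h.2.2 γ hγ _).2]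
  ring

end Convolution

section Eigenvalue

variable {F : Type*} [Field F] [ValuativeRel F] [TopologicalSpace F] [IsNonarchimedeanLocalField F]
  [MeasurableSpace PGL(2, F)] [BorelSpace PGL(2, F)]
  (dg : Measure PGL(2, F)) [dg.IsHaarMeasure] {x : 𝒪[F]ˣ →ₜ* ℂˣ} (θ : Theta x)

lemma integrable_mul_cellFun_inv (hx : x ^ 2 ≠ 1) (f : heckeX x) :
    Integrable (fun g => (f : PGL(2, F) → ℂ) g * cellFun θ g⁻¹) dg := by
  have h := integrable_piTheta dg θ.1 (Submodule.inclusion (heckeX_le x) f) (cellVec hx θ) 1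
  simp only [piTheta_apply, mul_one] at h
  exact h

variable (hx : x ^ 2 ≠ 1)

/-- The eigenvalue of `π_θ(f dg)` on the equivariant vector, as a linear functional of `f`. -/
def eigenvalue : heckeX x →ₗ[ℂ] ℂ where
  toFun f := ∫ g, (f : PGL(2, F) → ℂ) g * cellFun θ g⁻¹ ∂dg
  map_add' f h := by
    simp only [Submodule.coe_add, Pi.add_apply, add_mul]
    exact integral_add (integrable_mul_cellFun_inv dg θ hx f)
      (integrable_mul_cellFun_inv dg θ hx h)
  map_smul' c f := by
    simp only [Submodule.coe_smul, Pi.smul_apply, smul_eq_mul, RingHom.id_apply, mul_assoc]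
    exact integral_const_mul _ _

lemma piOp_eq_smul_cellVec (f : heckeX x) (v : inducedSpace θ.1) :
    piOp dg θ.1 (Submodule.inclusion (heckeX_le x) f) v =
      conv dg f v 1 • cellVec hx θ :=
  eq_smul_cellVec hx ((isLeftEquivariant_of_mem_heckeX f.2).conv dg v)

lemma piOp_cellVec (f : heckeX x) :
    piOp dg θ.1 (Submodule.inclusion (heckeX_le x) f) (cellVec hx θ) =
      eigenvalue dg θ hx f • cellVec hx θ := by
  rw [piOp_eq_smul_cellVec dg θ hx]
  congr 1
  change ∫ g, (f : PGL(2, F) → ℂ) g * cellFun θ (g⁻¹ * 1) ∂dg = _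
  simp only [mul_one]
  rfl

lemma conv_cellFun (f : heckeX x) :
    conv dg f (cellFun θ) = eigenvalue dg θ hx f • cellFun θ :=
  congrArg Subtype.val (piOp_cellVec dg θ hx f)

theorem finiteDimensional_range_piOp (hx : x ^ 2 ≠ 1) (f : heckeX x) :
    FiniteDimensional ℂ
      (LinearMap.range (piOp dg θ.1 (Submodule.inclusion (heckeX_le x) f))) :=
  Submodule.finiteDimensional_of_le
    (range_le_span_singleton fun v => ⟨_, piOp_eq_smul_cellVec dg θ hx f v⟩)

theorem finRankTrace_piOp (f : heckeX x) :
    finRankTrace (piOp dg θ.1 (Submodule.inclusion (heckeX_le x) f)) = eigenvalue dg θ hx f :=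
  finRankTrace_eq (cellVec_ne_zero hx θ) (fun v => ⟨_, piOp_eq_smul_cellVec dg θ hx f v⟩)
    (piOp_cellVec dg θ hx f)

theorem eigenvalue_conv (f h : heckeX x) :
    eigenvalue dg θ hx ⟨conv dg f h, conv_mem_heckeX dg hx f h⟩ =
      eigenvalue dg θ hx f * eigenvalue dg θ hx h := by
  have hassoc := congrFun (conv_assoc dg f.2.1.1.continuous f.2.1.2 h.2.1.1.continuous h.2.1.2
    (cellVec hx θ).2.1.continuous) 1
  have hfh := congrFun (conv_cellFun dg θ hx ⟨conv dg f h, conv_mem_heckeX dg hx f h⟩) 1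
  have hf := congrFun (conv_cellFun dg θ hx f) 1
  simp only [Pi.smul_apply, cellFun_one, smul_eq_mul, mul_one] at hf hfh
  rw [← hfh, ← hf]
  refine hassoc.trans ?_
  change conv dg f (conv dg h (cellFun θ)) 1 = _
  rw [conv_cellFun dg θ hx, conv, conv, ← integral_mul_const]
  simp only [Pi.smul_apply, smul_eq_mul, mul_assoc, mul_comm (eigenvalue dg θ hx h)]

end Eigenvalue

/-! ### The functions `φ_n` span the Hecke algebra -/

section Span

variable {F : Type*} [Field F] [ValuativeRel F] [TopologicalSpace F] {x : 𝒪[F]ˣ →ₜ* ℂˣ}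

lemma coe_apply_div_ne {y : 𝒪[F]ˣ} (hy : x y ^ 2 ≠ 1) : (x (y / 1) : ℂ) ≠ x (1 / y) := by
  rw [div_one, one_div, map_inv, Ne, Units.val_inj]
  exact fun h => hy (by rw [sq, ← eq_inv_iff_mul_eq_one, ← h])

variable [IsNonarchimedeanLocalField F] {f : PGL(2, F) → ℂ} {m : GL (Fin 2) F}

lemma apply_eq_zero_of_mul_eq_mul (hf : f ∈ heckeX x) {γ γ' g : PGL(2, F)}
    (hγ : γ ∈ Gamma F (depth x)) (hγ' : γ' ∈ Gamma F (depth x)) (h : γ * g = g * γ')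
    (hne : xTilde x γ ≠ xTilde x γ') : f g = 0 := by
  by_contra hg
  have hxTilde := (hf.2 γ hγ g).1
  rw [h, (hf.2 γ' hγ' g).2] at hxTilde
  exact hne (mul_right_cancel₀ hg hxTilde).symm

lemma exists_lower_left_eq (hx : x ^ 2 ≠ 1) (hf : f ∈ heckeX x) (hm : f (mk m) ≠ 0) :
    (∃ e ∈ 𝓂[F] ^ depth x, m 1 0 = e * m 0 0) ∨ ∃ e ∈ 𝓂[F] ^ depth x, m 1 0 = e * m 1 1 := by
  by_contra hcon
  obtain ⟨hm00, hm11⟩ := not_or.1 hcon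
  have hm0 : m 1 0 ≠ 0 := fun h => hm00 ⟨0, zero_mem _, by simp [h]⟩
  obtain ⟨y, hy, hxy⟩ := exists_sq_ne_one hx
  rw [← neg_mem_iff, neg_sub] at hy
  have hd : depth x + 0 = depth x - 1 + 1 := by have := depth_pos hx; omega
  obtain ⟨u, -, hu⟩ := exists_mem_maximalIdeal_pow_mul_eq hd hm00 hy
  obtain ⟨u', -, hu'⟩ := exists_mem_maximalIdeal_pow_mul_eq hd hm11 hy
  refine hm <| apply_eq_zero_of_mul_eq_mul hf (mk_upperTri_mem_Gamma _ y 1 u)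
    (mk_upperTri_mem_Gamma _ 1 y u') ?_ ?_
  · rw [map_one, ← map_mul, ← map_mul]
    exact congrArg mk (upperTri_mul_eq_mul_upperTri hm0 hu hu')
  · rw [xTilde_mk_upperTri, xTilde_mk_upperTri]
    exact coe_apply_div_ne hxy

lemma exists_upper_right_eq (hx : x ^ 2 ≠ 1) (hf : f ∈ heckeX x) (hm : f (mk m) ≠ 0) :
    (∃ e : 𝒪[F], m 0 1 = e * m 0 0) ∨ ∃ e : 𝒪[F], m 0 1 = e * m 1 1 := by
  by_contra hcon
  obtain ⟨hm00, hm11⟩ := not_or.1 hcon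
  have hm0 : m 0 1 ≠ 0 := fun h => hm00 ⟨0, by simp [h]⟩
  obtain ⟨y, hy, hxy⟩ := exists_sq_ne_one hx
  rw [← neg_mem_iff, neg_sub] at hy
  have hd : 0 + depth x = depth x - 1 + 1 := by have := depth_pos hx; omega
  obtain ⟨v, hv, hvm⟩ := exists_mem_maximalIdeal_pow_mul_eq hd
    (fun ⟨e, _, he⟩ => hm11 ⟨e, he⟩) hy
  obtain ⟨v', hv', hvm'⟩ := exists_mem_maximalIdeal_pow_mul_eq hd
    (fun ⟨e, _, he⟩ => hm00 ⟨e, he⟩) hy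
  refine hm <| apply_eq_zero_of_mul_eq_mul hf (mk_lowerTri_mem_Gamma 1 y hv)
    (mk_lowerTri_mem_Gamma y 1 hv') ?_ ?_
  · rw [map_one, ← map_mul, ← map_mul]
    exact congrArg mk (lowerTri_mul_eq_mul_lowerTri hm0 hvm hvm')
  · rw [xTilde_mk_lowerTri, xTilde_mk_lowerTri]
    exact (coe_apply_div_ne hxy).symm

lemma exists_eq_mul_or_eq_mul (a b : F) : (∃ e : 𝒪[F], b = e * a) ∨ ∃ e : 𝒪[F], a = e * b := by
  refine or_iff_not_imp_left.2 fun h => ?_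
  obtain ⟨e, -, he⟩ := exists_mem_maximalIdeal_pow_mul_eq (R := 𝒪[F]) (i := 0) (k := 1) (w := 1)
    rfl (fun ⟨e, _, he⟩ => h ⟨e, he⟩) (by simp)
  exact ⟨e, by rw [← one_mul a, ← map_one (algebraMap 𝒪[F] F), ← he]; rfl⟩

variable {ϖ : 𝒪[F]} (hϖ : Irreducible ϖ) {d : ℕ}

lemma exists_mk_diag_mem_tCoset (a b : Fˣ) : ∃ n, mk (upperTri a b 0) ∈ tCoset hϖ n d := by
  obtain ⟨u, n, hun⟩ := exists_eq_unitsIncl_mul_zpow hϖ (b / a)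
  have hmk : mk (upperTri a b 0) = diagHom (unitsIncl F u) * tElt ϖ hϖ ^ n := by
    rw [tElt_zpow, ← map_mul, ← hun]
    refine (Matrix.ProjGenLinGroup.mk_eq_mk_iff.2 ⟨a, ?_⟩).symm
    apply glTwo_ext <;> simp [GL_mul_apply, upperTri]
  have hu : diagHom (unitsIncl F u) ∈ Gamma F d := by
    simpa [diagHom] using mk_upperTri_mem_Gamma d 1 u 0
  exact ⟨n, DoubleCoset.mem_doubleCoset.2 ⟨_, hu, 1, one_mem _, by rw [hmk, mul_one]⟩⟩

lemma exists_mk_mem_tCoset_of_eq_mul_apply_zero_zero {e e' : 𝒪[F]} (he : e ∈ 𝓂[F] ^ d)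
    (h10 : m 1 0 = e * m 0 0) (h01 : m 0 1 = e' * m 0 0) : ∃ n, mk m ∈ tCoset hϖ n d := by
  have hdet : m 0 0 * (m 1 1 - e * m 0 1) ≠ 0 := by
    convert det_ne_zero m using 1
    rw [h10]
    ring
  have hm : m = lowerTri 1 1 (e : F) * upperTri (Units.mk0 _ (left_ne_zero_of_mul hdet))
      (Units.mk0 _ (right_ne_zero_of_mul hdet)) 0 * upperTri 1 1 (e' : F) := by
    apply glTwo_ext <;> simp [GL_mul_apply, lowerTri, upperTri, h10, h01] <;> ring
  obtain ⟨n, hn⟩ := exists_mk_diag_mem_tCoset hϖ (d := d) (Units.mk0 _ (left_ne_zero_of_mul hdet))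
    (Units.mk0 _ (right_ne_zero_of_mul hdet))
  refine ⟨n, ?_⟩
  rw [hm, map_mul, map_mul]
  refine (mul_mem_doubleCoset_iff_right ?_).2 ((mul_mem_doubleCoset_iff_left ?_).2 hn)
  · simpa using mk_upperTri_mem_Gamma d 1 1 e'
  · simpa using mk_lowerTri_mem_Gamma 1 1 he

lemma exists_mk_mem_tCoset_of_eq_mul_apply_one_one {e e' : 𝒪[F]} (he : e ∈ 𝓂[F] ^ d)
    (h10 : m 1 0 = e * m 1 1) (h01 : m 0 1 = e' * m 1 1) : ∃ n, mk m ∈ tCoset hϖ n d := by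
  have hdet : (m 0 0 - e' * m 1 0) * m 1 1 ≠ 0 := by
    convert det_ne_zero m using 1
    rw [h01]
    ring
  have hm : m = upperTri 1 1 (e' : F) * upperTri (Units.mk0 _ (left_ne_zero_of_mul hdet))
      (Units.mk0 _ (right_ne_zero_of_mul hdet)) 0 * lowerTri 1 1 (e : F) := by
    apply glTwo_ext <;> simp [GL_mul_apply, lowerTri, upperTri, h10, h01] <;> ring
  obtain ⟨n, hn⟩ := exists_mk_diag_mem_tCoset hϖ (d := d) (Units.mk0 _ (left_ne_zero_of_mul hdet))
    (Units.mk0 _ (right_ne_zero_of_mul hdet))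
  refine ⟨n, ?_⟩
  rw [hm, map_mul, map_mul]
  refine (mul_mem_doubleCoset_iff_right ?_).2 ((mul_mem_doubleCoset_iff_left ?_).2 hn)
  · simpa using mk_lowerTri_mem_Gamma 1 1 he
  · simpa using mk_upperTri_mem_Gamma d 1 1 e'

lemma exists_mem_tCoset (hx : x ^ 2 ≠ 1) (hf : f ∈ heckeX x) {g : PGL(2, F)} (hg : f g ≠ 0) :
    ∃ n, g ∈ tCoset hϖ n (depth x) := by
  obtain ⟨m, rfl⟩ := Matrix.ProjGenLinGroup.mk_surjective g
  have h10 := exists_lower_left_eq hx hf hg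
  have h01 := exists_upper_right_eq hx hf hg
  rcases exists_eq_mul_or_eq_mul (m 0 0) (m 1 1) with ⟨s, hs⟩ | ⟨s, hs⟩
  · obtain ⟨e, he, h10⟩ : ∃ e ∈ 𝓂[F] ^ depth x, m 1 0 = e * m 0 0 :=
      h10.elim id fun ⟨e, he, h⟩ => ⟨e * s, Ideal.mul_mem_right _ _ he, by
        rw [h, hs, Subring.coe_mul, mul_assoc]⟩
    obtain ⟨e', h01⟩ : ∃ e : 𝒪[F], m 0 1 = e * m 0 0 :=
      h01.elim id fun ⟨e, h⟩ => ⟨e * s, by rw [h, hs, Subring.coe_mul, mul_assoc]⟩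
    exact exists_mk_mem_tCoset_of_eq_mul_apply_zero_zero hϖ he h10 h01
  · obtain ⟨e, he, h10⟩ : ∃ e ∈ 𝓂[F] ^ depth x, m 1 0 = e * m 1 1 :=
      h10.elim (fun ⟨e, he, h⟩ => ⟨e * s, Ideal.mul_mem_right _ _ he, by
        rw [h, hs, Subring.coe_mul, mul_assoc]⟩) id
    obtain ⟨e', h01⟩ : ∃ e : 𝒪[F], m 0 1 = e * m 1 1 :=
      h01.elim (fun ⟨e, h⟩ => ⟨e * s, by rw [h, hs, Subring.coe_mul, mul_assoc]⟩) id
    exact exists_mk_mem_tCoset_of_eq_mul_apply_one_one hϖ he h10 h01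

lemma mem_span_phiVec_of_support_subset (hx : x ^ 2 ≠ 1) (S : Finset ℤ) (f : heckeX x)
    (hf : Function.support (f : PGL(2, F) → ℂ) ⊆ ⋃ n ∈ S, tCoset hϖ n (depth x)) :
    f ∈ Submodule.span ℂ (Set.range (phiVec hx hϖ)) := by
  induction S using Finset.induction_on generalizing f with
  | empty =>
    have hf0 : f = 0 := Subtype.ext (Function.support_eq_empty_iff.1 (by simpa using hf))
    exact hf0 ▸ zero_mem _
  | insert n S _ ih =>
    set c := (f : PGL(2, F) → ℂ) (tElt ϖ hϖ ^ n) with hc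
    have hzero : ∀ g ∈ tCoset hϖ n (depth x),
        (f : PGL(2, F) → ℂ) g - c * phi x ϖ hϖ n g = 0 := by
      intro g hg
      obtain ⟨γ, hγ, γ', hγ', rfl⟩ := DoubleCoset.mem_doubleCoset.1 hg
      rw [phi_apply hx hγ hγ', (f.2.2 γ' hγ' _).2, (f.2.2 γ hγ _).1, xTilde_mul hx hγ hγ', hc]
      ring
    have hmem : f - c • phiVec hx hϖ n ∈ Submodule.span ℂ (Set.range (phiVec hx hϖ)) := by
      refine ih _ fun g (hg : (f : PGL(2, F) → ℂ) g - c * phi x ϖ hϖ n g ≠ 0) => ?_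
      have hgn : g ∉ tCoset hϖ n (depth x) := fun h => hg (hzero g h)
      rw [phi_of_notMem_tCoset hgn, mul_zero, sub_zero] at hg
      simpa [hgn] using hf hg
    simpa using add_mem hmem (Submodule.smul_mem _ c (Submodule.subset_span ⟨n, rfl⟩))

theorem span_phiVec (hx : x ^ 2 ≠ 1) : Submodule.span ℂ (Set.range (phiVec hx hϖ)) = ⊤ := by
  refine eq_top_iff.2 fun f _ => ?_
  have hclosed : IsClosed (Function.support (f : PGL(2, F) → ℂ)) :=
    (f.2.1.1.isClopen_fiber 0).compl.1
  have hcover : tsupport (f : PGL(2, F) → ℂ) ⊆ ⋃ n, tCoset hϖ n (depth x) := by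
    rw [tsupport, hclosed.closure_eq]
    exact fun g hg => Set.mem_iUnion.2 (exists_mem_tCoset hϖ hx f.2 hg)
  obtain ⟨S, hS⟩ :=
    f.2.1.2.isCompact.elim_finite_subcover _ (fun _ => isOpen_tCoset _) hcover
  exact mem_span_phiVec_of_support_subset hϖ hx S f ((subset_tsupport _).trans hS)

end Span

/-! ### The eigenvalues of the functions `φ_n` -/

section PhiCell

variable {F : Type*} [Field F] [ValuativeRel F] [TopologicalSpace F] [IsNonarchimedeanLocalField F]
  {x : 𝒪[F]ˣ →ₜ* ℂˣ} {ϖ : 𝒪[F]} {hϖ : Irreducible ϖ} {n : ℤ}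

variable (hϖ x n) in
/-- The support of `g ↦ φ_n(g) v(g⁻¹)`, the integrand of the eigenvalue of `φ_n` on the
equivariant vector `v` of `R_θ`. -/
def phiCell : Set PGL(2, F) := tCoset hϖ n (depth x) ∩ (cell F (depth x))⁻¹

lemma isOpen_phiCell : IsOpen (phiCell x hϖ n) :=
  (isOpen_tCoset _).inter (isOpen_cell _).inv

lemma tElt_zpow_mem_phiCell : tElt ϖ hϖ ^ n ∈ phiCell x hϖ n := by
  refine ⟨DoubleCoset.mem_doubleCoset_self _ _ _, ?_⟩
  rw [Set.mem_inv, ← zpow_neg, tElt_zpow]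
  exact mem_cell_iff.2 ⟨1, one_mem _, 1, _, 0, (one_mul _).symm⟩

open scoped Pointwise in
lemma phiCell_zero : phiCell x hϖ 0 = Gamma F (depth x) := by
  have htCoset : tCoset hϖ 0 (depth x) = Gamma F (depth x) := by
    rw [tCoset, zpow_zero, DoubleCoset.doubleCoset, Set.singleton_one, mul_one,
      coe_mul_coe]
  rw [phiCell, htCoset, Set.inter_eq_left]
  intro g hg
  exact mem_cell_iff.2 ⟨g⁻¹, inv_mem hg, 1, 1, 0, by rw [upperTri_one, map_one, mul_one]⟩

lemma phi_mul_cellFun_inv (hx : x ^ 2 ≠ 1) (θ : Theta x) (g : PGL(2, F)) :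
    phi x ϖ hϖ n g * cellFun θ g⁻¹ =
      (phiCell x hϖ n).indicator (fun _ => chi θ.1 (unif ϖ hϖ ^ n : Fˣ)) g := by
  by_cases hg : g ∈ phiCell x hϖ n
  · rw [Set.indicator_of_mem hg]
    obtain ⟨hgt, hgc⟩ := hg
    obtain ⟨α, hα, β, hβ, rfl⟩ := DoubleCoset.mem_doubleCoset.1 hgt
    have hinv : (α * tElt ϖ hϖ ^ n * β)⁻¹ = β⁻¹ * (diagHom (unif ϖ hϖ ^ n)⁻¹ * α⁻¹) := by
      rw [tElt_zpow, map_inv]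
      group
    have hcell : diagHom (unif ϖ hϖ ^ n)⁻¹ * α⁻¹ ∈ cell F (depth x) :=
      (mul_mem_doubleCoset_iff_left (inv_mem hβ)).1 (hinv ▸ hgc)
    rw [phi_apply hx hα hβ, hinv, cellFun_mul_left hx θ _ (inv_mem hβ), cellFun, if_pos hcell,
      ratio_diagHom_mul, inv_inv, map_mul, chi_ratio hx θ (inv_mem hα), xTilde_mul hx hα hβ]
    linear_combination chi θ.1 (unif ϖ hϖ ^ n : Fˣ) * (xTilde x β * xTilde x β⁻¹ *
      xTilde_mul_xTilde_inv hx hα + xTilde_mul_xTilde_inv hx hβ)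
  · rw [Set.indicator_of_notMem hg]
    by_cases hgt : g ∈ tCoset hϖ n (depth x)
    · have hcell : g⁻¹ ∉ cell F (depth x) := fun hgc => hg ⟨hgt, hgc⟩
      rw [cellFun, if_neg hcell, mul_zero]
    · rw [phi_of_notMem_tCoset hgt, zero_mul]

end PhiCell

section Eigenvalue

variable {F : Type*} [Field F] [ValuativeRel F] [TopologicalSpace F] [IsNonarchimedeanLocalField F]
  [MeasurableSpace PGL(2, F)] (dg : Measure PGL(2, F)) {x : 𝒪[F]ˣ →ₜ* ℂˣ} {ϖ : 𝒪[F]}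
  {hϖ : Irreducible ϖ}

variable (x hϖ) in
/-- The constant `c` such that the trace of `φ_n` on `R_θ` is `c zⁿ`, where `z = θ(ϖ)`. -/
def phiConst (n : ℤ) : ℂ := dg.real (phiCell x hϖ n) * Real.sqrt (normAbs (unif ϖ hϖ ^ n))

lemma phiConst_zero : phiConst dg x hϖ 0 = dg.real (Gamma F (depth x)) := by
  have : normAbs (1 : Fˣ) = 1 := by simpa using normAbs_unitsIncl (1 : 𝒪[F]ˣ)
  rw [phiConst, phiCell_zero, zpow_zero, this, Real.sqrt_one, Complex.ofReal_one, mul_one]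

variable [dg.IsHaarMeasure]

lemma phiConst_ne_zero (n : ℤ) : phiConst dg x hϖ n ≠ 0 := by
  have hpos : 0 < dg.real (phiCell x hϖ n) :=
    ENNReal.toReal_pos (isOpen_phiCell.measure_pos dg ⟨_, tElt_zpow_mem_phiCell⟩).ne'
      ((measure_mono Set.inter_subset_left).trans_lt (isCompact_tCoset _).measure_lt_top).ne
  rw [phiConst, ← Complex.ofReal_mul, Complex.ofReal_ne_zero]
  exact (mul_pos hpos (Real.sqrt_pos.2 (normAbs_pos _))).ne'

theorem eigenvalue_phiVec [BorelSpace PGL(2, F)] (hx : x ^ 2 ≠ 1) (hϖ : Irreducible ϖ)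
    (θ : Theta x) (n : ℤ) :
    eigenvalue dg θ hx (phiVec hx hϖ n) =
      phiConst dg x hϖ n * ((θ.1 (unif ϖ hϖ) ^ n : ℂˣ) : ℂ) := by
  calc ∫ g, phi x ϖ hϖ n g * cellFun θ g⁻¹ ∂dg
      = ∫ g, (phiCell x hϖ n).indicator (fun _ => chi θ.1 (unif ϖ hϖ ^ n : Fˣ)) g ∂dg := by
        simp only [phi_mul_cellFun_inv hx]
    _ = dg.real (phiCell x hϖ n) * chi θ.1 (unif ϖ hϖ ^ n : Fˣ) := by
        rw [integral_indicator_const _ isOpen_phiCell.measurableSet, Complex.real_smul]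
    _ = phiConst dg x hϖ n * ((θ.1 (unif ϖ hϖ) ^ n : ℂˣ) : ℂ) := by
        rw [chi_coe, phiConst, map_zpow]
        ring

end Eigenvalue

/-! ### Laurent polynomials -/

section Laurent

/-- Evaluation of Laurent polynomials at a point of `ℂˣ`, as a linear functional. -/
def evalLin (z : ℂˣ) : ℂ[T;T⁻¹] →ₗ[ℂ] ℂ where
  toFun := LaurentPolynomial.eval₂ (RingHom.id ℂ) z
  map_add' := map_add _
  map_smul' c p := by simp [LaurentPolynomial.smul_eq_C_mul]

lemma evalLin_mul (z : ℂˣ) (p r : ℂ[T;T⁻¹]) : evalLin z (p * r) = evalLin z p * evalLin z r :=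
  map_mul (LaurentPolynomial.eval₂ (RingHom.id ℂ) z) p r

lemma eq_of_forall_evalLin_eq {p r : ℂ[T;T⁻¹]} (h : ∀ z, evalLin z p = evalLin z r) : p = r := by
  rw [← sub_eq_zero]
  obtain ⟨n, f, hf⟩ := (p - r).exists_T_pow
  have hroot (z : ℂˣ) : f.eval (z : ℂ) = 0 := by
    calc f.eval (z : ℂ) = evalLin z (Polynomial.toLaurent f) :=
          (LaurentPolynomial.eval₂_toLaurent _ z f).symm
      _ = 0 := by rw [hf, evalLin_mul, map_sub, h, sub_self, zero_mul]
  have hXf : Polynomial.X * f = 0 := Polynomial.funext fun a => by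
    rcases eq_or_ne a 0 with rfl | ha
    · simp
    · simp [show f.eval a = 0 from hroot (Units.mk0 a ha)]
  rw [(mul_eq_zero.1 hXf).resolve_left Polynomial.X_ne_zero, map_zero] at hf
  exact (LaurentPolynomial.isUnit_T (n : ℤ)).mul_left_eq_zero.1 hf.symm

/-- The basis of the Laurent polynomials consisting of the multiples `c n • T n`. -/
def laurentBasis {c : ℤ → ℂ} (hc : ∀ n, c n ≠ 0) : Module.Basis ℤ ℂ ℂ[T;T⁻¹] :=
  (AddMonoidAlgebra.basis ℤ ℂ).isUnitSMul fun n => (hc n).isUnit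

lemma laurentBasis_apply {c : ℤ → ℂ} (hc : ∀ n, c n ≠ 0) (n : ℤ) :
    laurentBasis hc n = c n • LaurentPolynomial.T n := by
  rw [laurentBasis, Module.Basis.isUnitSMul_apply]
  rfl

lemma evalLin_laurentBasis {c : ℤ → ℂ} (hc : ∀ n, c n ≠ 0) (z : ℂˣ) (n : ℤ) :
    evalLin z (laurentBasis hc n) = c n * ((z ^ n : ℂˣ) : ℂ) := by
  rw [laurentBasis_apply, map_smul, smul_eq_mul]
  exact congrArg (c n * ·) (LaurentPolynomial.eval₂_T _ _ n)

end Laurent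

/-! ### The isomorphism -/

section Isomorphism

variable {F : Type*} [Field F] [ValuativeRel F] [TopologicalSpace F] [IsNonarchimedeanLocalField F]
  [MeasurableSpace PGL(2, F)] (dg : Measure PGL(2, F)) [dg.IsHaarMeasure]
  {x : 𝒪[F]ˣ →ₜ* ℂˣ} {ϖ : 𝒪[F]} (hx : x ^ 2 ≠ 1) (hϖ : Irreducible ϖ)

/-- The linear map from the Laurent polynomials to the Hecke algebra with `c_n Tⁿ ↦ φ_n`, where
`c_n zⁿ` is the eigenvalue of `φ_n`; the inverse of the isomorphism `f ↦ (θ ↦ tr π_θ(f))`. -/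
def laurentToHecke : ℂ[T;T⁻¹] →ₗ[ℂ] heckeX x :=
  (laurentBasis (phiConst_ne_zero (x := x) (hϖ := hϖ) dg)).constr ℂ (phiVec hx hϖ)

lemma laurentToHecke_smul_T (n : ℤ) :
    laurentToHecke dg hx hϖ (phiConst dg x hϖ n • LaurentPolynomial.T n) = phiVec hx hϖ n := by
  rw [← laurentBasis_apply (phiConst_ne_zero dg), laurentToHecke, Module.Basis.constr_basis]

variable [BorelSpace PGL(2, F)]

lemma eigenvalue_laurentToHecke (θ : Theta x) (p : ℂ[T;T⁻¹]) :
    eigenvalue dg θ hx (laurentToHecke dg hx hϖ p) = evalLin (θ.1 (unif ϖ hϖ)) p := by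
  have hcomp : eigenvalue dg θ hx ∘ₗ laurentToHecke dg hx hϖ = evalLin (θ.1 (unif ϖ hϖ)) := by
    refine (laurentBasis (phiConst_ne_zero (x := x) (hϖ := hϖ) dg)).ext fun n => ?_
    rw [LinearMap.comp_apply, evalLin_laurentBasis, laurentBasis_apply, laurentToHecke_smul_T,
      eigenvalue_phiVec]
  exact LinearMap.congr_fun hcomp p

lemma bijective_laurentToHecke : Function.Bijective (laurentToHecke dg hx hϖ) := by
  constructor
  · intro p r hpr
    refine eq_of_forall_evalLin_eq fun z => ?_
    obtain ⟨θ, rfl⟩ := (bijective_apply_unif hϖ x).2 z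
    change evalLin (θ.1 (unif ϖ hϖ)) p = evalLin (θ.1 (unif ϖ hϖ)) r
    rw [← eigenvalue_laurentToHecke dg hx hϖ, ← eigenvalue_laurentToHecke dg hx hϖ, hpr]
  · rw [← LinearMap.range_eq_top, laurentToHecke, Module.Basis.constr_range, span_phiVec]

/-- The isomorphism `f ↦ (θ ↦ tr π_θ(f))` of the Hecke algebra with the Laurent polynomials in
`z = θ(ϖ)`. -/
def heckeEquiv : heckeX x ≃ₗ[ℂ] ℂ[T;T⁻¹] :=
  (LinearEquiv.ofBijective _ (bijective_laurentToHecke dg hx hϖ)).symm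

theorem evalLin_heckeEquiv (θ : Theta x) (f : heckeX x) :
    evalLin (θ.1 (unif ϖ hϖ)) (heckeEquiv dg hx hϖ f) = eigenvalue dg θ hx f := by
  rw [← eigenvalue_laurentToHecke dg hx hϖ]
  exact congrArg _ ((heckeEquiv dg hx hϖ).symm_apply_apply f)

lemma heckeEquiv_phiVec (n : ℤ) :
    heckeEquiv dg hx hϖ (phiVec hx hϖ n) = phiConst dg x hϖ n • LaurentPolynomial.T n :=
  (LinearEquiv.symm_apply_eq _).2 (laurentToHecke_smul_T dg hx hϖ n).symm

theorem heckeEquiv_conv (f h : heckeX x) :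
    heckeEquiv dg hx hϖ ⟨conv dg f h, conv_mem_heckeX dg hx f h⟩ =
      heckeEquiv dg hx hϖ f * heckeEquiv dg hx hϖ h := by
  refine eq_of_forall_evalLin_eq fun z => ?_
  obtain ⟨θ, rfl⟩ := (bijective_apply_unif hϖ x).2 z
  simp only [evalLin_mul, evalLin_heckeEquiv, eigenvalue_conv]

lemma heckeEquiv_unit :
    heckeEquiv dg hx hϖ ((dg.real (Gamma F (depth x)) : ℂ)⁻¹ • phiVec hx hϖ 0) = 1 := by
  rw [← phiConst_zero (hϖ := hϖ), map_smul, heckeEquiv_phiVec,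
    inv_smul_smul₀ (phiConst_ne_zero dg 0), LaurentPolynomial.T_zero]

/-- The basis of the Hecke algebra given by the functions `φ_n`. -/
def phiBasis : Module.Basis ℤ ℂ (heckeX x) :=
  (laurentBasis (phiConst_ne_zero (x := x) (hϖ := hϖ) dg)).map (heckeEquiv dg hx hϖ).symm

lemma phiBasis_apply (n : ℤ) : phiBasis dg hx hϖ n = phiVec hx hϖ n := by
  rw [phiBasis, Module.Basis.map_apply, laurentBasis_apply, LinearEquiv.symm_apply_eq,
    heckeEquiv_phiVec]

end Isomorphism

end PGL2Hecke

end

theorem lemma6p3 {F : Type*} [Field F] [ValuativeRel F] [TopologicalSpace F]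
    [IsNonarchimedeanLocalField F] [MeasurableSpace PGL(2, F)] [BorelSpace PGL(2, F)]
    (dg : Measure PGL(2, F)) [dg.IsHaarMeasure]
    (ϖ : 𝒪[F]) (hϖ : Irreducible ϖ) (x : 𝒪[F]ˣ →ₜ* ℂˣ) (hx : x ^ 2 ≠ 1) :
    -- `θ ↦ θ(ϖ)` identifies `Θ_x` with `ℂˣ`
    Function.Bijective (fun θ : Theta x => θ.1 (unif ϖ hϖ)) ∧
    -- the operators `π_θ(f dg)` have finite rank, so that their traces are defined
    (∀ (θ : Theta x) (f : heckeX x),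
      FiniteDimensional ℂ (LinearMap.range (piOp dg θ.1 (Submodule.inclusion (heckeX_le x) f)))) ∧
    -- `φ_n` takes the prescribed values on its double coset
    (∀ (n : ℤ), ∀ γ ∈ Gamma F (depth x), ∀ γ' ∈ Gamma F (depth x),
      phi x ϖ hϖ n (γ * tElt ϖ hϖ ^ n * γ') = xTilde x (γ * γ')) ∧
    ∃ Φ : heckeX x ≃ₗ[ℂ] ℂ[T;T⁻¹],
      -- `Φ` is the map `μ ↦ (θ ↦ tr π_θ(μ))`
      (∀ (f : heckeX x) (θ : Theta x),
        LaurentPolynomial.eval₂ (RingHom.id ℂ) (θ.1 (unif ϖ hϖ)) (Φ f) =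
          finRankTrace (piOp dg θ.1 (Submodule.inclusion (heckeX_le x) f))) ∧
      -- `Φ` is an isomorphism of unital algebras for the convolution product
      (∀ f h : heckeX x, ∃ hfh : conv dg f h ∈ heckeX x, Φ ⟨conv dg f h, hfh⟩ = Φ f * Φ h) ∧
      (∃ h1 : (fun g => ((dg.real (Gamma F (depth x)) : ℂ))⁻¹ * phi x ϖ hϖ 0 g) ∈ heckeX x,
        Φ ⟨_, h1⟩ = 1) ∧
      -- the elements `μ_n = φ_n dg` form a basis and go to nonzero multiples of `zⁿ`
      ∃ b : Module.Basis ℤ ℂ (heckeX x),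
        (∀ n, (b n : PGL(2, F) → ℂ) = phi x ϖ hϖ n) ∧
        ∀ n, ∃ c : ℂ, c ≠ 0 ∧ Φ (b n) = c • LaurentPolynomial.T n := by
  refine ⟨bijective_apply_unif hϖ x, fun θ f => finiteDimensional_range_piOp dg θ hx f,
    fun n γ hγ γ' hγ' => phi_apply hx hγ hγ', heckeEquiv dg hx hϖ, fun f θ => ?_,
    fun f h => ⟨conv_mem_heckeX dg hx f h, heckeEquiv_conv dg hx hϖ f h⟩,
    ⟨((dg.real (Gamma F (depth x)) : ℂ)⁻¹ • phiVec hx hϖ 0).2, heckeEquiv_unit dg hx hϖ⟩,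
    phiBasis dg hx hϖ, fun n => congrArg Subtype.val (phiBasis_apply dg hx hϖ n),
    fun n => ⟨phiConst dg x hϖ n, phiConst_ne_zero dg n, ?_⟩⟩
  · rw [finRankTrace_piOp dg θ hx]
    exact evalLin_heckeEquiv dg hx hϖ θ f
  · rw [phiBasis_apply, heckeEquiv_phiVec]
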